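/- \textbf{Setting.} The Parikh image of a word over a finite alphabet $\Sigma$ is the vector in $\mathbb{N}^{\Sigma}$ that counts the occurrences of each letter; the Parikh image of a language is the set of the Parikh images of its words. A one-counter automaton (OCA) is a nondeterministic finite automaton (possibly with $\varepsilon$-moves) equipped with a counter that holds a nonnegative integer, initially $0$; a transition may increment the counter, decrement it (if it is positive), leave it unchanged, or test it for zero, and a word is accepted if some run on it ends in a final state. The size of an OCA is its number of states plus the size of its alphabet plus its number of transitions. An OCA and an NFA over the same alphabet are Parikh-equivalent if their languages have the same Parikh image. For an even integer $n\ge 2$, the universal one-counter set $U_n$ is the set of vectors $(y_{ij},x_i)=(y_{ij}: 0\le i<j<n;\ x_i: 0\le i<n)$ of nonnegative integers, regarded as Parikh images over the alphabet $\{c_{ij}:0\le i<j<n\}\cup\{a_i:0\le i<n\}$ (with $y_{ij}$ counting $c_{ij}$ and $x_i$ counting $a_i$), such that: (1) $y_{ij}\in\{0,1\}$, and the pairs $(i,j)$ with $y_{ij}=1$ are precisely the edges of a monotone directed path from $0$ to $n-1$; (2) $\sum_{i=0}^{n-1}(-1)^i x_i=0$, and $\sum_{i=0}^{k}(-1)^i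 x_i\ge 0$ for all $0\le k<n-1$; (3) if $x_j>0$ and $j>0$, then $y_{ij}=1$ for some $i$; if $x_j>0$ and $j<n-1$, then $y_{jk}=1$ for some $k$. \textbf{Corollary.} (a) Every NFA that recognizes a language with Parikh image $U_n$ has $n^{\Omega(\sqrt{\log n/\log\log n})}$ states; that is, there are a constant $c>0$ and an integer $N$ such that for every even $n\ge N$ every such NFA has at least $n^{c\sqrt{\log n/\log\log n}}$ states. (b) For every even $n\ge 2$, $U_n$ is the Parikh image of a language recognized by an OCA with $n+2$ states. Consequently there is no polynomial translation from OCA to Parikh-equivalent NFA: there is no polynomial $P$ such that every OCA of size $s$ has a Parikh-equivalent NFA with at most $P(s)$ states. -/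

import Mathlib

/-- The Parikh image of a word: how many times each letter occurs in it. -/
def parikhVector {α : Type} [DecidableEq α] (w : List α) : α → ℕ := fun a => w.count a

/-- The Parikh image of a language: the set of the Parikh images of its words. -/
def parikhImage {α : Type} [DecidableEq α] (L : Language α) : Set (α → ℕ) :=
  {v | ∃ w ∈ L, parikhVector w = v}

/-- Operations of a one-counter automaton on its counter. -/
inductive CounterOp where
  | inc
  | dec
  | nop
  | zeroTest

/-- `o.Step c d`: the operation `o` can be performed at counter value `c`, and changes it to `d`.
The counter stays nonnegative: `dec` is blocked at `0`. -/
def CounterOp.Step : CounterOp → ℕ → ℕ → Prop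
  | .inc, c, d => d = c + 1
  | .dec, c, d => c = d + 1
  | .nop, c, d => d = c
  | .zeroTest, c, d => c = 0 ∧ d = 0

/-- A (nondeterministic) one-counter automaton over the alphabet `α` with set of states `Q`.
A transition `(q, a, o, q')` leads from `q` to `q'`, reads the letter `a` (nothing if `a = none`)
and performs `o` on the counter. -/
structure OCA (α Q : Type) where
  /-- the transitions -/
  trans : Finset (Q × Option α × CounterOp × Q)
  /-- the initial state -/
  start : Q
  /-- the final states -/
  accept : Set Q

namespace OCA

variable {α Q : Type}

/-- `A.Run q c w r d`: there is a run of `A` from state `q` with counter value `c` to state `r`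
with counter value `d` that reads the word `w`. -/
inductive Run (A : OCA α Q) : Q → ℕ → List α → Q → ℕ → Prop
  | nil (q : Q) (c : ℕ) : Run A q c [] q c
  | cons (q q' r : Q) (c c' d : ℕ) (a : Option α) (o : CounterOp) (w : List α) :
      (q, a, o, q') ∈ A.trans → o.Step c c' → Run A q' c' w r d →
        Run A q c (a.toList ++ w) r d

/-- The language recognized by `A`: the words read by the runs that start in the initial state with
counter value `0` and end in a final state. -/
def accepts (A : OCA α Q) : Language α :=
  {w | ∃ q ∈ A.accept, ∃ d : ℕ, A.Run A.start 0 w q d}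

/-- The description size of `A`: number of states, plus number of letters, plus number of
transitions. -/
def size [Fintype α] [Fintype Q] (A : OCA α Q) : ℕ :=
  Fintype.card Q + Fintype.card α + A.trans.card

end OCA

/-- The alphabet `{c_{ij} : 0 ≤ i < j < n} ∪ {a_i : 0 ≤ i < n}`. -/
abbrev UnivLetter (n : ℕ) : Type := {p : Fin n × Fin n // p.1 < p.2} ⊕ Fin n

/-- The letter `c_{ij}`. -/
def letterC {n : ℕ} (i j : Fin n) (h : i < j) : UnivLetter n := Sum.inl ⟨(i, j), h⟩

/-- The letter `a_i`. -/
def letterA {n : ℕ} (i : Fin n) : UnivLetter n := Sum.inr i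

/-- The components `y_{ij}` are `0` or `1`, and the edges `(i, j)` with `y_{ij} = 1` are exactly
the edges of a monotone path `p 0 < p 1 < ⋯ < p t` from `0` to `n - 1`. -/
def IsChainVector {n : ℕ} (v : UnivLetter n → ℕ) : Prop :=
  (∀ (i j : Fin n) (h : i < j), v (letterC i j h) = 0 ∨ v (letterC i j h) = 1) ∧
  ∃ (t : ℕ) (p : Fin (t + 1) → Fin n), StrictMono p ∧
    (p 0 : ℕ) = 0 ∧ (p (Fin.last t) : ℕ) + 1 = n ∧
    ∀ (i j : Fin n) (h : i < j),
      v (letterC i j h) = 1 ↔ ∃ s : Fin t, p s.castSucc = i ∧ p s.succ = j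

/-- Balance: the alternating sum of all the `x_i` is `0`, and the alternating sum of
`x_0, …, x_k` is nonnegative for each `k < n - 1`. -/
def IsBalanced {n : ℕ} (v : UnivLetter n → ℕ) : Prop :=
  ∑ i : Fin n, (-1 : ℤ) ^ (i : ℕ) * (v (letterA i) : ℤ) = 0 ∧
  ∀ k : Fin n, (k : ℕ) + 1 < n →
    0 ≤ ∑ i ∈ Finset.Iic k, (-1 : ℤ) ^ (i : ℕ) * (v (letterA i) : ℤ)

/-- Compatibility: if `x_j > 0`, then the chain has an edge into `j` (unless `j = 0`) and an edge
out of `j` (unless `j = n - 1`). -/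
def IsCompatible {n : ℕ} (v : UnivLetter n → ℕ) : Prop :=
  ∀ j : Fin n, 0 < v (letterA j) →
    (0 < (j : ℕ) → ∃ (i : Fin n) (h : i < j), v (letterC i j h) = 1) ∧
    ((j : ℕ) + 1 < n → ∃ (k : Fin n) (h : j < k), v (letterC j k h) = 1)

/-- The universal one-counter set `U_n`. -/
def universalOneCounterSet (n : ℕ) : Set (UnivLetter n → ℕ) :=
  {v | IsChainVector v ∧ IsBalanced v ∧ IsCompatible v}

/-!
Let the parities of the inner nodes of a chain spell a Dyck word `σ`, and let each of these nodes
`i` carry the same large number of letters `a_i`. An automaton for `U_n` accepts a word for this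
chain; cut it into windows. What is read between two states can be completed to an accepted word by
a bounded number of letters, so every window is almost balanced. By Hall's theorem the symbols of
`σ` can therefore be re-paired such that the two symbols of a pair occur in a common window, with
different windows for different pairs; erase the pairs in the order of their windows. For a suitable
`σ` of length `m`, whichever way it is re-paired, there is a time at which the erased symbols
alternate with the others about `√(log m / log log m)` times. Cut the word at that time: of any two
neighbouring symbols that alternate, one belongs to a node with letters on both sides of the cut,
since the edge between their nodes is read on one of the two sides.

If the words for two chains are cut in the same state, their halves can be exchanged, and the result
is again a word for a chain; hence a node that has letters on both sides of both cuts lies on both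
chains. There are `Q ^ m` ways to choose each of `m` nodes among `Q` candidates, and by this remark
each state and each set of `A` positions accounts for at most `Q ^ (m - A)` of them. Thus the
automaton has at least `Q ^ A / m ^ A` states, where `A` is half the number of alternations. This
exceeds every polynomial in `n` when `Q` is about `n / m` and `m` is a small power of `n`.
-/

open scoped Finset

/-! ### Re-pairings of Dyck words -/

/-- The height of the bracket word `σ` after its first `i` symbols; an opening bracket is encoded
as `1` and a closing one as `-1`. -/
def height (σ : ℕ → ℤ) (i : ℕ) : ℤ := ∑ x ∈ Finset.range i, σ x

/-- The first `m` symbols of `σ` form a Dyck word. -/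
structure IsDyck (σ : ℕ → ℤ) (m : ℕ) : Prop where
  sign : ∀ i < m, σ i = 1 ∨ σ i = -1
  height_nonneg : ∀ i ≤ m, 0 ≤ height σ i
  height_eq_zero : height σ m = 0

/-- A re-pairing of the first `m` symbols of the bracket word `σ`: the involution `π` pairs each
opening bracket with a closing bracket to its right, and the pairs are erased one after another,
the pair of `i` at time `τ i`. The pairs may cross, unlike in the usual matching of brackets. -/
structure RePairing (σ : ℕ → ℤ) (m : ℕ) (π τ : ℕ → ℕ) : Prop where
  lt : ∀ i < m, π i < m
  invol : ∀ i < m, π (π i) = i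
  bracket : ∀ i < m, σ i = 1 ∧ σ (π i) = -1 ∧ i < π i ∨ σ i = -1 ∧ σ (π i) = 1 ∧ π i < i
  time_pair : ∀ i < m, τ (π i) = τ i
  time_inj : ∀ i < m, ∀ j < m, τ i = τ j → j = i ∨ j = π i

/-- The number of places in the factor `[a, b)` where exactly one of two neighbouring symbols
satisfies `e` (say, is erased). -/
def alternations (e : ℕ → Prop) [DecidablePred e] (a b : ℕ) : ℕ :=
  #{i ∈ Finset.Ico a (b - 1) | ¬(e i ↔ e (i + 1))}

/-- The sum of the symbols of the factor `[a, b)` of `σ` that satisfy `e` (say, are erased). -/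
def erasedSum (σ : ℕ → ℤ) (e : ℕ → Prop) [DecidablePred e] (a b : ℕ) : ℤ :=
  ∑ i ∈ Finset.Ico a b with e i, σ i

section Height

variable {σ ρ : ℕ → ℤ}

theorem height_succ (σ : ℕ → ℤ) (i : ℕ) : height σ (i + 1) = height σ i + σ i :=
  Finset.sum_range_succ σ i

theorem height_add_of_eq {a l : ℕ} (h : ∀ x < l, σ (a + x) = ρ x) :
    height σ (a + l) = height σ a + height ρ l := by
  rw [height, Finset.sum_range_add]
  exact congrArg _ (Finset.sum_congr rfl fun x hx => h x (Finset.mem_range.1 hx))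

theorem height_const (z : ℤ) (i : ℕ) : height (fun _ => z) i = i * z := by
  simp [height]

end Height

namespace RePairing

variable {σ : ℕ → ℤ} {m : ℕ} {π τ : ℕ → ℕ}

theorem sum_eq_zero (h : RePairing σ m π τ) {T : Finset ℕ} (hT : ∀ i ∈ T, i < m)
    (hπ : ∀ i ∈ T, π i ∈ T) : ∑ i ∈ T, σ i = 0 := by
  refine Finset.sum_involution (fun i _ => π i) (fun i hi => ?_) (fun i hi _ heq => ?_) hπ
    fun i hi => h.invol i (hT i hi)
  · have := h.bracket i (hT i hi); omega
  · have := h.bracket i (hT i hi); omega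

theorem card_crossing (h : RePairing σ m π τ) {a : ℕ} (ha : a ≤ m) :
    (#{i ∈ Finset.range a | a ≤ π i} : ℤ) = height σ a := by
  have hinner : ∑ i ∈ Finset.range a with ¬ a ≤ π i, σ i = 0 := by
    refine h.sum_eq_zero (fun i hi => ?_) fun i hi => ?_ <;>
      simp only [Finset.mem_filter, Finset.mem_range] at hi ⊢
    · omega
    · rw [h.invol i (by omega)]
      omega
  rw [height, ← Finset.sum_filter_add_sum_filter_not (Finset.range a) (fun i => a ≤ π i), hinner,
    add_zero, Finset.card_eq_sum_ones, Nat.cast_sum]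
  refine Finset.sum_congr rfl fun i hi => ?_
  simp only [Finset.mem_filter, Finset.mem_range] at hi
  have := h.bracket i (by omega)
  omega

theorem card_leaving_le (h : RePairing σ m π τ) {a b : ℕ} (hab : a ≤ b) (hb : b ≤ m) :
    (#{i ∈ Finset.Ico a b | ¬(a ≤ π i ∧ π i < b)} : ℤ) ≤ height σ a + height σ b := by
  rw [← h.card_crossing (hab.trans hb), ← h.card_crossing hb]
  norm_cast
  rw [← Finset.card_filter_add_card_filter_not (s := {i ∈ Finset.Ico a b | _}) (fun i => π i < a)]
  gcongr ?_ + ?_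
  · refine Finset.card_le_card_of_injOn π (fun i hi => ?_) fun i hi j hj hij => ?_
    · simp only [Finset.coe_filter, Finset.mem_filter, Finset.mem_Ico, Finset.mem_range,
        Set.mem_ofPred_eq] at hi ⊢
      rw [h.invol i (by omega)]
      omega
    · simp only [Finset.coe_filter, Finset.mem_filter, Finset.mem_Ico,
        Set.mem_ofPred_eq] at hi hj
      rw [← h.invol i (by omega), hij, h.invol j (by omega)]
  · refine Finset.card_le_card fun i hi => ?_
    simp only [Finset.mem_filter, Finset.mem_Ico, Finset.mem_range] at hi ⊢
    omega

theorem exists_leaving_of_erasedSum_ne (h : RePairing σ m π τ) {a b r r' : ℕ} (hb : b ≤ m)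
    (hr : r ≤ r') (hne : erasedSum σ (τ · < r) a b ≠ erasedSum σ (τ · < r') a b) :
    ∃ i ∈ Finset.Ico a b, ¬(a ≤ π i ∧ π i < b) ∧ r ≤ τ i ∧ τ i < r' := by
  contrapose! hne with hpaired
  have hbetween : ∑ i ∈ {i ∈ Finset.Ico a b | τ i < r'} with ¬ τ i < r, σ i = 0 := by
    refine h.sum_eq_zero (fun i hi => ?_) fun i hi => ?_ <;>
      simp only [Finset.mem_filter, Finset.mem_Ico] at hi ⊢
    · omega
    · rw [h.time_pair i (by omega)]
      have := hpaired i (Finset.mem_Ico.2 hi.1.1)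
      omega
  rw [erasedSum, erasedSum, ← Finset.sum_filter_add_sum_filter_not
    {i ∈ Finset.Ico a b | τ i < r'} (fun i => τ i < r), hbetween, add_zero, Finset.filter_filter]
  refine Finset.sum_congr (Finset.filter_congr fun i _ => ?_) fun _ _ => rfl
  omega

/-- Each change of the erased sum of a factor takes the erasure of a pair with exactly one symbol in
the factor. -/
theorem card_changes_le (h : RePairing σ m π τ) {a b n : ℕ} (hab : a ≤ b) (hb : b ≤ m)
    {s : ℕ → ℕ} (hs : StrictMonoOn s (Set.Iic n))
    (hne : ∀ k < n, erasedSum σ (τ · < s k) a b ≠ erasedSum σ (τ · < s (k + 1)) a b) :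
    (n : ℤ) ≤ height σ a + height σ b := by
  refine le_trans ?_ (h.card_leaving_le hab hb)
  have hmono := hs.monotoneOn
  have hchange : ∀ k : Fin n, ∃ i ∈ Finset.Ico a b, ¬(a ≤ π i ∧ π i < b) ∧
      s k ≤ τ i ∧ τ i < s (k + 1) := fun k =>
    h.exists_leaving_of_erasedSum_ne hb
      (hmono (Set.mem_Iic.2 k.2.le) (Set.mem_Iic.2 k.2) (Nat.le_succ _)) (hne k k.2)
  choose f hf using hchange
  have hτf : StrictMono (τ ∘ f) := fun k k' hkk' =>
    calc τ (f k) < s (k + 1) := (hf k).2.2.2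
      _ ≤ s k' := hmono (Set.mem_Iic.2 k.2) (Set.mem_Iic.2 k'.2.le) hkk'
      _ ≤ τ (f k') := (hf k').2.2.1
  simpa using Finset.card_le_card_of_injOn (s := Finset.univ)
    (t := {i ∈ Finset.Ico a b | ¬(a ≤ π i ∧ π i < b)}) f
    (fun k _ => Finset.mem_filter.2 ⟨(hf k).1, (hf k).2.1⟩) hτf.injective.of_comp.injOn

end RePairing

section Alternations

theorem iff_of_iff_succ {e : ℕ → Prop} {x y : ℕ} (hxy : x ≤ y)
    (h : ∀ i, x ≤ i → i < y → (e i ↔ e (i + 1))) : e x ↔ e y := by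
  induction y, hxy using Nat.le_induction with
  | base => rfl
  | succ n hn ih => exact (ih fun i hi hin => h i hi (by omega)).trans (h n hn (by omega))

variable {e : ℕ → Prop} [DecidablePred e] {a b u v : ℕ}

theorem alternations_mono (hu : a ≤ u) (hv : v ≤ b) : alternations e u v ≤ alternations e a b :=
  Finset.card_le_card (Finset.filter_subset_filter _ (Finset.Ico_subset_Ico hu (by omega)))

theorem alternations_not : alternations (fun i => ¬ e i) a b = alternations e a b := by
  simp only [alternations, not_iff_not]

theorem iff_succ_of_alternations_le (hu : a ≤ u) (hv : v ≤ b)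
    (hle : alternations e a b ≤ alternations e u v) {i : ℕ} (hi : a ≤ i) (hib : i + 1 < b)
    (hout : i < u ∨ v ≤ i + 1) : e i ↔ e (i + 1) := by
  by_contra hne
  have heq := Finset.eq_of_subset_of_card_le (Finset.filter_subset_filter
    (fun i => ¬(e i ↔ e (i + 1))) (Finset.Ico_subset_Ico (b₁ := v - 1) hu (by omega))) hle
  have hmem : i ∈ {i ∈ Finset.Ico a (b - 1) | ¬(e i ↔ e (i + 1))} :=
    Finset.mem_filter.2 ⟨Finset.mem_Ico.2 ⟨hi, by omega⟩, hne⟩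
  rw [← heq, Finset.mem_filter, Finset.mem_Ico] at hmem
  omega

theorem iff_left_of_alternations_le (hv : v ≤ b) (huv : u < v)
    (hle : alternations e a b ≤ alternations e u v) {i : ℕ} (hi : a ≤ i) (hiu : i ≤ u) :
    e i ↔ e a :=
  (iff_of_iff_succ hi fun x hx hxi =>
    iff_succ_of_alternations_le (i := x) (hi.trans hiu) hv hle hx (by omega)
      (Or.inl (by omega))).symm

theorem iff_right_of_alternations_le (hu : a ≤ u) (huv : u < v)
    (hle : alternations e a b ≤ alternations e u v) {i : ℕ} (hvi : v ≤ i) (hi : i < b) :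
    e i ↔ e (b - 1) :=
  iff_of_iff_succ (by omega) fun x hx hxi =>
    iff_succ_of_alternations_le (i := x) hu (by omega) hle (by omega) (by omega) (Or.inr (by omega))

theorem exists_and_exists_not_of_alternations_pos (h : 0 < alternations e a b) :
    (∃ i ∈ Finset.Ico a b, e i) ∧ ∃ i ∈ Finset.Ico a b, ¬ e i := by
  obtain ⟨i, hi⟩ := Finset.card_pos.1 h
  rw [Finset.mem_filter, Finset.mem_Ico] at hi
  have hi₀ : i ∈ Finset.Ico a b := Finset.mem_Ico.2 (by omega)
  have hi₁ : i + 1 ∈ Finset.Ico a b := Finset.mem_Ico.2 (by omega)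
  by_cases he : e i
  · exact ⟨⟨i, hi₀, he⟩, i + 1, hi₁, by tauto⟩
  · exact ⟨⟨i + 1, hi₁, by tauto⟩, i, hi₀, he⟩

end Alternations

section ErasedSum

variable {σ : ℕ → ℤ} {e : ℕ → Prop} [DecidablePred e] {a b c : ℕ}

theorem erasedSum_add (hab : a ≤ b) (hbc : b ≤ c) :
    erasedSum σ e a b + erasedSum σ e b c = erasedSum σ e a c := by
  simp only [erasedSum, Finset.sum_filter]
  exact Finset.sum_Ico_consecutive _ hab hbc

theorem erasedSum_of_forall (hab : a ≤ b) (h : ∀ i ∈ Finset.Ico a b, e i) :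
    erasedSum σ e a b = height σ b - height σ a := by
  rw [erasedSum, Finset.filter_true_of_mem h, Finset.sum_Ico_eq_sub _ hab, height, height]

theorem erasedSum_of_forall_not (h : ∀ i ∈ Finset.Ico a b, ¬ e i) : erasedSum σ e a b = 0 := by
  rw [erasedSum, Finset.filter_false_of_mem h, Finset.sum_empty]

theorem erasedSum_add_erasedSum_not (hab : a ≤ b) :
    erasedSum σ e a b + erasedSum σ (fun i => ¬ e i) a b = height σ b - height σ a := by
  rw [erasedSum, erasedSum, Finset.sum_filter_add_sum_filter_not, Finset.sum_Ico_eq_sub _ hab,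
    height, height]

/-- Summation by parts: the erased runs that end inside the factor contribute a difference of two
heights each, hence at most `G`. -/
theorem abs_erasedSum_sub_le {G : ℤ} (hlow : ∀ i ∈ Finset.Icc a b, height σ a ≤ height σ i)
    (hupp : ∀ i ∈ Finset.Icc a b, height σ i ≤ height σ a + G) {k : ℕ} (hak : a ≤ k) (hk : k < b) :
    |erasedSum σ e a (k + 1) - if e k then height σ (k + 1) - height σ a else 0| ≤
      alternations e a (k + 1) * G := by
  simp only [Finset.mem_Icc] at hlow hupp
  induction k, hak using Nat.le_induction with
  | base =>
    simp [erasedSum, alternations, Finset.sum_filter, height_succ]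
  | succ k hak ih =>
    have ih := ih (by omega)
    have := hlow (k + 1) (by omega)
    have := hupp (k + 1) (by omega)
    have hsum : erasedSum σ e a (k + 1 + 1) =
        erasedSum σ e a (k + 1) + if e (k + 1) then σ (k + 1) else 0 := by
      simp only [erasedSum, Finset.sum_filter, Finset.sum_Ico_succ_top (show a ≤ k + 1 by omega)]
    have halt : (alternations e a (k + 1 + 1) : ℤ) =
        alternations e a (k + 1) + if e k ↔ e (k + 1) then 0 else 1 := by
      simp only [alternations, Nat.add_sub_cancel, Finset.card_filter,
        Finset.sum_Ico_succ_top hak, ite_not, Nat.cast_add, Nat.cast_ite, Nat.cast_zero,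
        Nat.cast_one]
    rw [hsum, halt, height_succ σ (k + 1)]
    rw [abs_le] at ih ⊢
    by_cases h₁ : e k <;> by_cases h₂ : e (k + 1) <;>
      simp only [h₁, h₂, if_true, if_false, iff_true, iff_false, not_true] at ih ⊢ <;>
      constructor <;> linarith

theorem abs_erasedSum_le {G : ℤ} (hlow : ∀ i ∈ Finset.Icc a b, height σ a ≤ height σ i)
    (hupp : ∀ i ∈ Finset.Icc a b, height σ i ≤ height σ a + G) (hab : a < b)
    (heq : height σ b = height σ a) : |erasedSum σ e a b| ≤ alternations e a b * G := by
  obtain ⟨k, rfl⟩ : ∃ k, b = k + 1 := ⟨b - 1, by omega⟩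
  simpa [heq] using abs_erasedSum_sub_le (e := e) hlow hupp (Nat.le_of_lt_succ hab) k.lt_succ_self

end ErasedSum

/-! ### Sweeps -/

open scoped Finset

theorem strictMonoOn_or_strictAntiOn_of_iff {t : ℕ → ℕ} {L R : ℕ → Prop} {n : ℕ} (hn : 2 ≤ n)
    (hne : ∀ c < n, ∀ c' < c, t c' ≠ t c) (hL : ∀ c < n, ∀ c' < c, (L c ↔ t c' < t c))
    (hR : ∀ c' < n, ∀ c < c', (R c ↔ t c' < t c)) :
    StrictMonoOn t (Set.Iio n) ∧ (∀ c < n, 0 < c → L c) ∧ (∀ c, c + 1 < n → ¬ R c) ∨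
      StrictAntiOn t (Set.Iio n) ∧ (∀ c < n, 0 < c → ¬ L c) ∧ (∀ c, c + 1 < n → R c) := by
  have hlast : n - 1 < n := by omega
  rcases lt_or_gt_of_ne (hne (n - 1) hlast 0 (by omega)) with hlt | hgt
  · have hR₀ : ¬ R 0 := fun h => lt_asymm hlt ((hR (n - 1) hlast 0 (by omega)).1 h)
    have hLc : ∀ c < n, 0 < c → L c := fun c hc hc₀ => (hL c hc 0 hc₀).2 <|
      lt_of_le_of_ne (not_lt.1 fun h => hR₀ ((hR c hc 0 hc₀).2 h)) (hne c hc 0 hc₀)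
    have hmono : ∀ c < n, ∀ c' < c, t c' < t c := fun c hc c' hc' =>
      (hL c hc c' hc').1 (hLc c hc (by omega))
    refine Or.inl ⟨fun c _ c' hc' hcc' => hmono c' hc' c hcc', hLc, fun c hc hRc => ?_⟩
    exact lt_asymm (hmono (c + 1) hc c (by omega)) ((hR (c + 1) hc c (by omega)).1 hRc)
  · have hR₀ : R 0 := (hR (n - 1) hlast 0 (by omega)).2 hgt
    have hLc : ∀ c < n, 0 < c → ¬ L c := fun c hc hc₀ h =>
      lt_asymm ((hR c hc 0 hc₀).1 hR₀) ((hL c hc 0 hc₀).1 h)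
    have hanti : ∀ c < n, ∀ c' < c, t c < t c' := fun c hc c' hc' =>
      lt_of_le_of_ne (not_lt.1 fun h => hLc c hc (by omega) ((hL c hc c' hc').2 h))
        (hne c hc c' hc').symm
    exact Or.inr ⟨fun c _ c' hc' hcc' => hanti c' hc' c hcc', hLc, fun c hc =>
      (hR (c + 1) hc c (by omega)).2 (hanti (c + 1) hc c (by omega))⟩

theorem ne_and_iff_lt_of_alternations_pos {τ : ℕ → ℕ} {a b r s : ℕ} {p : Prop}
    (hpos : 0 < alternations (τ · < r) a b) (h : ∀ i ∈ Finset.Ico a b, τ i < s ↔ p) :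
    r ≠ s ∧ (p ↔ r < s) := by
  obtain ⟨⟨x, hx, hxr⟩, y, hy, hyr⟩ := exists_and_exists_not_of_alternations_pos hpos
  have hsame := (h x hx).trans (h y hy).symm
  refine ⟨by rintro rfl; exact hyr (hsame.1 hxr), (h x hx).symm.trans ?_⟩
  omega

/-- At the time `t c` the alternations of the whole word all lie in `[u c, v c)`, so nothing changes
to the left of `u c` or to the right of `v c`: the erasure sweeps through the word from left to
right, or else from right to left. -/
theorem exists_sweep {τ t u v : ℕ → ℕ} {b n : ℕ} (hn : 2 ≤ n)
    (hvb : ∀ c < n, v c ≤ b) (hvu : ∀ c' < n, ∀ c < c', v c ≤ u c')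
    (hpos : ∀ c < n, 0 < alternations (τ · < t c) (u c) (v c))
    (hle : ∀ c < n, alternations (τ · < t c) (u 0) b ≤ alternations (τ · < t c) (u c) (v c)) :
    StrictMonoOn t (Set.Iio n) ∧ (∀ c, c + 1 < n →
      (∀ i ∈ Finset.Ico (u 0) (u c), τ i < t c) ∧ ∀ i ∈ Finset.Ico (v c) b, ¬ τ i < t c) ∨
    StrictAntiOn t (Set.Iio n) ∧ (∀ c, c + 1 < n →
      (∀ i ∈ Finset.Ico (u 0) (u c), ¬ τ i < t c) ∧ ∀ i ∈ Finset.Ico (v c) b, τ i < t c) := by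
  simp only [Finset.mem_Ico]
  have huv : ∀ c < n, u c < v c := fun c hc => by
    obtain ⟨⟨i, hi, -⟩, -⟩ := exists_and_exists_not_of_alternations_pos (hpos c hc)
    rw [Finset.mem_Ico] at hi
    omega
  have hu₀ : ∀ c < n, u 0 ≤ u c := fun c hc => by
    rcases Nat.eq_zero_or_pos c with rfl | hc₀
    · rfl
    · exact (huv 0 (by omega)).le.trans (hvu c hc 0 hc₀)
  have hleft : ∀ c < n, ∀ i, u 0 ≤ i → i ≤ u c → (τ i < t c ↔ τ (u 0) < t c) := fun c hc _ hi hic =>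
    iff_left_of_alternations_le (hvb c hc) (huv c hc) (hle c hc) hi hic
  have hright : ∀ c < n, ∀ i, v c ≤ i → i < b → (τ i < t c ↔ τ (b - 1) < t c) :=
    fun c hc _ hi hib => iff_right_of_alternations_le (hu₀ c hc) (huv c hc) (hle c hc) hi hib
  have hL : ∀ c < n, ∀ c' < c, t c' ≠ t c ∧ (τ (u 0) < t c ↔ t c' < t c) := fun c hc c' hc' =>
    ne_and_iff_lt_of_alternations_pos (hpos c' (hc'.trans hc)) fun i hi =>
      hleft c hc i ((hu₀ c' (hc'.trans hc)).trans (Finset.mem_Ico.1 hi).1)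
        ((Finset.mem_Ico.1 hi).2.le.trans (hvu c hc c' hc'))
  have hR : ∀ c' < n, ∀ c < c', (τ (b - 1) < t c ↔ t c' < t c) := fun c' hc' c hc =>
    (ne_and_iff_lt_of_alternations_pos (hpos c' hc') fun i hi =>
      hright c (hc.trans hc') i ((hvu c' hc' c hc).trans (Finset.mem_Ico.1 hi).1)
        ((Finset.mem_Ico.1 hi).2.trans_le (hvb c' hc'))).2
  have hc₀ : ∀ {c i}, u 0 ≤ i → i < u c → 0 < c := fun {c i} hi hic =>
    Nat.pos_of_ne_zero fun h => by subst h; omega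
  refine (strictMonoOn_or_strictAntiOn_of_iff hn (fun c hc c' hc' => (hL c hc c' hc').1)
    (fun c hc c' hc' => (hL c hc c' hc').2) hR).imp ?_ ?_ <;> rintro ⟨ht, hLt, hRt⟩ <;>
    refine ⟨ht, fun c hc => ⟨fun i hi => ?_, fun i hi => ?_⟩⟩
  · exact (hleft c (by omega) i hi.1 hi.2.le).2 (hLt c (by omega) (hc₀ hi.1 hi.2))
  · exact (hright c (by omega) i hi.1 hi.2).not.2 (hRt c hc)
  · exact (hleft c (by omega) i hi.1 hi.2.le).not.2 (hLt c (by omega) (hc₀ hi.1 hi.2))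
  · exact (hright c (by omega) i hi.1 hi.2).2 (hRt c hc)

/-! ### Dyck words that are hard to re-pair -/

/-- The length of the hard word of level `j`. -/
def hardWordLen (M C : ℕ) : ℕ → ℕ
  | 0 => 4
  | j + 1 => C * (hardWordLen M C j + M * (M + 1) ^ j)

/-- The length of a cell of the hard word of level `j + 1`: a copy of the hard word of level `j`
and a block of `M * (M + 1) ^ j` equal brackets. -/
def hardCellLen (M C j : ℕ) : ℕ := hardWordLen M C j + M * (M + 1) ^ j

/-- The hard word of level `0` is `()()`, and that of level `j + 1` consists of `C` cells, each of
them the hard word of level `j` followed by a block of brackets, which are opening in the even cells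
and closing in the odd ones. The copies of the hard word of level `j` thus lie alternately at the
heights `0` and `M * (M + 1) ^ j`. -/
def hardWord (M C : ℕ) : ℕ → ℕ → ℤ
  | 0, i => if i % 2 = 0 then 1 else -1
  | j + 1, i =>
    if i % hardCellLen M C j < hardWordLen M C j then hardWord M C j (i % hardCellLen M C j)
    else if i / hardCellLen M C j % 2 = 0 then 1 else -1

section HardWord

variable {M C j c x : ℕ}

theorem hardWordLen_succ (M C j : ℕ) : hardWordLen M C (j + 1) = C * hardCellLen M C j := rfl

theorem hardWordLen_pos (hC : 0 < C) (j : ℕ) : 0 < hardWordLen M C j := by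
  induction j with
  | zero => exact Nat.zero_lt_succ _
  | succ j ih => exact Nat.mul_pos hC (Nat.add_pos_left ih _)

theorem hardWord_sign (M C j i : ℕ) : hardWord M C j i = 1 ∨ hardWord M C j i = -1 := by
  induction j generalizing i with
  | zero => simp only [hardWord]; split_ifs <;> simp
  | succ j ih => simp only [hardWord]; split_ifs <;> first | exact ih _ | simp

theorem hardWord_succ_copy (hx : x < hardWordLen M C j) :
    hardWord M C (j + 1) (c * hardCellLen M C j + x) = hardWord M C j x := by
  have hmod : (c * hardCellLen M C j + x) % hardCellLen M C j = x := by
    rw [mul_comm, Nat.mul_add_mod, Nat.mod_eq_of_lt]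
    exact hx.trans_le (Nat.le_add_right _ _)
  simp only [hardWord, hmod, if_pos hx]

theorem hardWord_succ_block (hx : x < M * (M + 1) ^ j) :
    hardWord M C (j + 1) (c * hardCellLen M C j + hardWordLen M C j + x) =
      if c % 2 = 0 then 1 else -1 := by
  have hlt : hardWordLen M C j + x < hardCellLen M C j := Nat.add_lt_add_left hx _
  have hmod : (c * hardCellLen M C j + hardWordLen M C j + x) % hardCellLen M C j =
      hardWordLen M C j + x := by
    rw [add_assoc, mul_comm, Nat.mul_add_mod, Nat.mod_eq_of_lt hlt]
  have hdiv : (c * hardCellLen M C j + hardWordLen M C j + x) / hardCellLen M C j = c := by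
    rw [add_assoc, mul_comm, Nat.mul_add_div (by omega), Nat.div_eq_of_lt hlt, add_zero]
  simp only [hardWord, hmod, hdiv, if_neg (Nat.not_lt.2 (Nat.le_add_right _ x))]

theorem height_hardWord_succ_copy (hx : x ≤ hardWordLen M C j) :
    height (hardWord M C (j + 1)) (c * hardCellLen M C j + x) =
      height (hardWord M C (j + 1)) (c * hardCellLen M C j) + height (hardWord M C j) x :=
  height_add_of_eq fun _ hy => hardWord_succ_copy (hy.trans_le hx)

theorem height_hardWord_succ_block (hx : x ≤ M * (M + 1) ^ j) :
    height (hardWord M C (j + 1)) (c * hardCellLen M C j + hardWordLen M C j + x) =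
      height (hardWord M C (j + 1)) (c * hardCellLen M C j) +
        height (hardWord M C j) (hardWordLen M C j) + x * (if c % 2 = 0 then 1 else -1) := by
  rw [height_add_of_eq fun _ hy => hardWord_succ_block (hy.trans_le hx), height_const,
    height_hardWord_succ_copy le_rfl]

theorem height_hardWord_succ_cell (hzero : height (hardWord M C j) (hardWordLen M C j) = 0)
    (c : ℕ) : height (hardWord M C (j + 1)) (c * hardCellLen M C j) =
      ((c % 2 : ℕ) : ℤ) * (M * (M + 1) ^ j : ℕ) := by
  induction c with
  | zero => simp [height]
  | succ c ih =>
    have hcell : (c + 1) * hardCellLen M C j =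
        c * hardCellLen M C j + hardWordLen M C j + M * (M + 1) ^ j := by
      rw [hardCellLen]; ring
    rw [hcell, height_hardWord_succ_block le_rfl, ih, hzero]
    rcases Nat.mod_two_eq_zero_or_one c with h | h <;> simp [h, Nat.add_mod]

theorem height_hardWordLen (hC : Even C) (j : ℕ) :
    height (hardWord M C j) (hardWordLen M C j) = 0 := by
  induction j with
  | zero => simp [height, hardWordLen, hardWord, Finset.sum_range_succ]
  | succ j ih => rw [hardWordLen_succ, height_hardWord_succ_cell ih, Nat.even_iff.1 hC]; simp

theorem height_hardWord_mem_Icc (hC : Even C) (hC₀ : 0 < C) {i : ℕ}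
    (hi : i ≤ hardWordLen M C j) :
    height (hardWord M C j) i ∈ Set.Icc 0 (((M + 1) ^ j : ℕ) : ℤ) := by
  induction j generalizing i with
  | zero => unfold hardWordLen at hi; interval_cases i <;>
      simp [height, Finset.sum_range_succ, hardWord]
  | succ j ih =>
    have hpow : (((M + 1) ^ (j + 1) : ℕ) : ℤ) = (M * (M + 1) ^ j : ℕ) + ((M + 1) ^ j : ℕ) := by
      push_cast; ring
    rw [← Nat.div_add_mod' i (hardCellLen M C j), hpow]
    generalize i / hardCellLen M C j = c
    have hlt : i % hardCellLen M C j < hardCellLen M C j :=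
      Nat.mod_lt _ ((hardWordLen_pos hC₀ j).trans_le (Nat.le_add_right _ _))
    generalize i % hardCellLen M C j = x at hlt
    have hcell := height_hardWord_succ_cell (height_hardWordLen (M := M) hC j) c
    rcases le_total x (hardWordLen M C j) with hx | hx
    · rw [height_hardWord_succ_copy hx, hcell]
      obtain ⟨h₀, h₁⟩ := ih hx
      rcases Nat.mod_two_eq_zero_or_one c with h | h <;> rw [h] <;> constructor <;> omega
    · obtain ⟨y, rfl⟩ := Nat.exists_eq_add_of_le hx
      have hy : y ≤ M * (M + 1) ^ j := by
        unfold hardCellLen at hlt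
        omega
      rw [← add_assoc, height_hardWord_succ_block hy, hcell, height_hardWordLen hC j]
      rcases Nat.mod_two_eq_zero_or_one c with h | h <;> rw [h] <;> constructor <;> norm_num <;>
        norm_cast <;> omega

theorem isDyck_hardWord (hC : Even C) (hC₀ : 0 < C) (j : ℕ) :
    IsDyck (hardWord M C j) (hardWordLen M C j) where
  sign i _ := hardWord_sign M C j i
  height_nonneg _ hi := (height_hardWord_mem_Icc hC hC₀ hi).1
  height_eq_zero := height_hardWordLen hC j

variable {σ : ℕ → ℤ} {a : ℕ} {e : ℕ → Prop} [DecidablePred e]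

theorem mul_hardCellLen_add_le (hc : c < C) :
    c * hardCellLen M C j + hardCellLen M C j ≤ hardWordLen M C (j + 1) :=
  calc c * hardCellLen M C j + hardCellLen M C j = (c + 1) * hardCellLen M C j := by ring
    _ ≤ C * hardCellLen M C j := Nat.mul_le_mul_right _ hc

theorem end_copy_le (a : ℕ) (hc : c < C) :
    a + c * hardCellLen M C j + hardWordLen M C j ≤ a + hardWordLen M C (j + 1) := by
  have := mul_hardCellLen_add_le (M := M) (j := j) hc
  have : hardWordLen M C j ≤ hardCellLen M C j := Nat.le_add_right _ _
  omega

theorem end_copy_le_start_copy (a : ℕ) {c' : ℕ} (hcc' : c < c') :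
    a + c * hardCellLen M C j + hardWordLen M C j ≤ a + c' * hardCellLen M C j := by
  have := Nat.mul_le_mul_right (hardCellLen M C j) (Nat.succ_le_of_lt hcc')
  have : hardWordLen M C j ≤ hardCellLen M C j := Nat.le_add_right _ _
  rw [Nat.succ_mul] at *
  omega

theorem height_start_copy (hC : Even C)
    (hocc : ∀ i < hardWordLen M C (j + 1), σ (a + i) = hardWord M C (j + 1) i) (hc : c < C) :
    height σ (a + c * hardCellLen M C j) =
      height σ a + ((c % 2 : ℕ) : ℤ) * (M * (M + 1) ^ j : ℕ) := by
  have hle := mul_hardCellLen_add_le (M := M) (j := j) hc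
  rw [height_add_of_eq fun x hx => hocc x (by omega),
    height_hardWord_succ_cell (height_hardWordLen hC j)]

theorem occurrence_copy
    (hocc : ∀ i < hardWordLen M C (j + 1), σ (a + i) = hardWord M C (j + 1) i) (hc : c < C) :
    ∀ i < hardWordLen M C j, σ (a + c * hardCellLen M C j + i) = hardWord M C j i := fun i hi => by
  have hle := mul_hardCellLen_add_le (M := M) (j := j) hc
  unfold hardCellLen at hle ⊢
  rw [add_assoc, hocc _ (by omega)]
  exact hardWord_succ_copy hi

theorem abs_erasedSum_hardWord_le (hC : Even C) (hC₀ : 0 < C)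
    (hocc : ∀ i < hardWordLen M C j, σ (a + i) = hardWord M C j i) :
    |erasedSum σ e a (a + hardWordLen M C j)| ≤
      alternations e a (a + hardWordLen M C j) * ((M + 1) ^ j : ℕ) := by
  have hheight : ∀ i ∈ Finset.Icc a (a + hardWordLen M C j),
      height σ a ≤ height σ i ∧ height σ i ≤ height σ a + ((M + 1) ^ j : ℕ) := fun i hi => by
    obtain ⟨ha, hb⟩ := Finset.mem_Icc.1 hi
    obtain ⟨x, rfl⟩ := Nat.exists_eq_add_of_le ha
    rw [height_add_of_eq fun y hy => hocc y (by omega)]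
    obtain ⟨h₀, h₁⟩ := height_hardWord_mem_Icc (M := M) (j := j) hC hC₀ (i := x) (by omega)
    omega
  refine abs_erasedSum_le (fun i hi => (hheight i hi).1) (fun i hi => (hheight i hi).2)
    (Nat.lt_add_of_pos_right (hardWordLen_pos hC₀ j)) ?_
  rw [height_add_of_eq hocc, height_hardWordLen hC, add_zero]

/-- The erased symbols before the copy `c` add up to the height at which it lies, and the copy
itself contributes little. -/
theorem two_mul_abs_erasedSum_sub_lt (hC : Even C) (hM : 2 * j + 3 ≤ M)
    (hocc : ∀ i < hardWordLen M C (j + 1), σ (a + i) = hardWord M C (j + 1) i) (hc : c < C)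
    (halt : alternations e (a + c * hardCellLen M C j)
      (a + c * hardCellLen M C j + hardWordLen M C j) ≤ j + 1)
    (hleft : ∀ i ∈ Finset.Ico a (a + c * hardCellLen M C j), e i)
    (hright : ∀ i ∈ Finset.Ico (a + c * hardCellLen M C j + hardWordLen M C j)
      (a + hardWordLen M C (j + 1)), ¬ e i) :
    2 * |erasedSum σ e a (a + hardWordLen M C (j + 1)) -
      ((c % 2 : ℕ) : ℤ) * (M * (M + 1) ^ j : ℕ)| < (M * (M + 1) ^ j : ℕ) := by
  have hle := mul_hardCellLen_add_le (M := M) (j := j) hc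
  have hlen : hardWordLen M C j ≤ hardCellLen M C j := Nat.le_add_right _ _
  have hsplit : erasedSum σ e a (a + hardWordLen M C (j + 1)) =
      ((c % 2 : ℕ) : ℤ) * (M * (M + 1) ^ j : ℕ) + erasedSum σ e (a + c * hardCellLen M C j)
        (a + c * hardCellLen M C j + hardWordLen M C j) := by
    rw [← erasedSum_add (b := a + c * hardCellLen M C j + hardWordLen M C j) (by omega) (by omega),
      ← erasedSum_add (b := a + c * hardCellLen M C j) (by omega) (by omega),
      erasedSum_of_forall (by omega) hleft, erasedSum_of_forall_not hright,
      height_start_copy hC hocc hc]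
    ring
  rw [hsplit, add_sub_cancel_left]
  have hcopy := abs_erasedSum_hardWord_le (e := e) hC (by omega) (occurrence_copy hocc hc)
  calc 2 * |erasedSum σ e _ _| ≤ 2 * ((j + 1 : ℕ) * ((M + 1) ^ j : ℕ)) := by
        have : (0 : ℤ) ≤ ((M + 1) ^ j : ℕ) := Int.natCast_nonneg _
        refine mul_le_mul_of_nonneg_left (hcopy.trans ?_) two_pos.le
        gcongr
    _ < (M * (M + 1) ^ j : ℕ) := by
        have : 0 < (M + 1) ^ j := by positivity
        norm_cast
        nlinarith

theorem two_mul_abs_erasedSum_add_lt (hC : Even C) (hM : 2 * j + 3 ≤ M)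
    (hocc : ∀ i < hardWordLen M C (j + 1), σ (a + i) = hardWord M C (j + 1) i) (hc : c < C)
    (halt : alternations e (a + c * hardCellLen M C j)
      (a + c * hardCellLen M C j + hardWordLen M C j) ≤ j + 1)
    (hleft : ∀ i ∈ Finset.Ico a (a + c * hardCellLen M C j), ¬ e i)
    (hright : ∀ i ∈ Finset.Ico (a + c * hardCellLen M C j + hardWordLen M C j)
      (a + hardWordLen M C (j + 1)), e i) :
    2 * |erasedSum σ e a (a + hardWordLen M C (j + 1)) +
      ((c % 2 : ℕ) : ℤ) * (M * (M + 1) ^ j : ℕ)| < (M * (M + 1) ^ j : ℕ) := by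
  have hnot := two_mul_abs_erasedSum_sub_lt (e := fun i => ¬ e i) hC hM hocc hc
    (alternations_not.trans_le halt) hleft fun i hi => not_not_intro (hright i hi)
  have hadd := erasedSum_add_erasedSum_not (σ := σ) (e := e) (a := a)
    (b := a + hardWordLen M C (j + 1)) (Nat.le_add_right _ _)
  rw [height_add_of_eq hocc, height_hardWordLen hC, add_zero, sub_self] at hadd
  rwa [eq_neg_of_add_eq_zero_right hadd, ← neg_add', abs_neg] at hnot

theorem ne_of_two_mul_abs_sub_lt {y z g δ : ℤ} (hδ : δ = 1 ∨ δ = -1)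
    (hy : 2 * |y - δ * (((c % 2 : ℕ) : ℤ) * g)| < g)
    (hz : 2 * |z - δ * ((((c + 1) % 2 : ℕ) : ℤ) * g)| < g) : y ≠ z := by
  rintro rfl
  have hparity : |δ * (((c % 2 : ℕ) : ℤ) * g) - δ * ((((c + 1) % 2 : ℕ) : ℤ) * g)| = |g| := by
    rcases Nat.mod_two_eq_zero_or_one c with h | h <;> rcases hδ with rfl | rfl <;>
      simp [h, Nat.add_mod]
  have htri := abs_sub_le (δ * (((c % 2 : ℕ) : ℤ) * g)) y (δ * ((((c + 1) % 2 : ℕ) : ℤ) * g))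
  rw [hparity, abs_sub_comm _ y] at htri
  linarith [le_abs_self g]

/-- The erasure sweeps through the copies, and the erased sum follows the heights at which they lie,
which differ for neighbouring copies. -/
theorem exists_strictMonoOn_erasedSum_ne {τ t : ℕ → ℕ} (hC : Even C) (hC₂ : 2 ≤ C)
    (hM : 2 * j + 3 ≤ M)
    (hocc : ∀ i < hardWordLen M C (j + 1), σ (a + i) = hardWord M C (j + 1) i)
    (ht : ∀ c < C, j + 1 ≤ alternations (τ · < t c) (a + c * hardCellLen M C j)
      (a + c * hardCellLen M C j + hardWordLen M C j))
    (hmax : ∀ r, alternations (τ · < r) a (a + hardWordLen M C (j + 1)) ≤ j + 1) :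
    ∃ s : ℕ → ℕ, StrictMonoOn s (Set.Iic (C - 2)) ∧ ∀ k < C - 2,
      erasedSum σ (τ · < s k) a (a + hardWordLen M C (j + 1)) ≠
        erasedSum σ (τ · < s (k + 1)) a (a + hardWordLen M C (j + 1)) := by
  have hcell := fun c (hc : c < C) => end_copy_le (M := M) (j := j) a hc
  have halt : ∀ c < C, alternations (τ · < t c) (a + c * hardCellLen M C j)
      (a + c * hardCellLen M C j + hardWordLen M C j) ≤ j + 1 := fun c hc =>
    (alternations_mono (Nat.le_add_right _ _) (hcell c hc)).trans (hmax _)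
  rcases exists_sweep (u := fun c => a + c * hardCellLen M C j) hC₂ hcell
    (fun _ _ _ hcc' => end_copy_le_start_copy a hcc')
    (fun c hc => (Nat.succ_pos j).trans_le (ht c hc))
    (fun c hc => by simpa using (hmax (t c)).trans (ht c hc)) with ⟨hmono, hside⟩ | ⟨hanti, hside⟩
  all_goals simp only [zero_mul, add_zero] at hside
  · have hclose := fun c (hc : c + 1 < C) => two_mul_abs_erasedSum_sub_lt hC hM hocc
      (by omega) (halt c (by omega)) (hside c hc).1 (hside c hc).2
    refine ⟨t, hmono.mono fun k hk => ?_, fun k hk => ne_of_two_mul_abs_sub_lt (Or.inl rfl)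
      (by simpa using hclose k (by omega)) (by simpa using hclose (k + 1) (by omega))⟩
    rw [Set.mem_Iic] at hk
    exact Set.mem_Iio.2 (by omega)
  · have hclose := fun c (hc : c + 1 < C) => two_mul_abs_erasedSum_add_lt hC hM hocc
      (by omega) (halt c (by omega)) (hside c hc).1 (hside c hc).2
    refine ⟨fun k => t (C - 2 - k), fun k _ k' hk' hkk' => hanti ?_ ?_ ?_, fun k hk => ?_⟩
    · exact Set.mem_Iio.2 (by omega)
    · exact Set.mem_Iio.2 (by omega)
    · rw [Set.mem_Iic] at hk'
      omega
    · have hk' : C - 2 - k = C - 2 - (k + 1) + 1 := by omega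
      simp only [hk']
      exact (ne_of_two_mul_abs_sub_lt (Or.inr rfl)
        (by simpa using hclose (C - 2 - (k + 1)) (by omega))
        (by simpa using hclose (C - 2 - (k + 1) + 1) (by omega))).symm

theorem alternations_pos_of_ne {b : ℕ} {τ : ℕ → ℕ} {i : ℕ} (ha : a ≤ i) (hb : i + 1 < b)
    (hne : τ i ≠ τ (i + 1)) : 0 < alternations (τ · < max (τ i) (τ (i + 1))) a b := by
  refine Finset.card_pos.2 ⟨i, Finset.mem_filter.2 ⟨Finset.mem_Ico.2 ⟨ha, by omega⟩, ?_⟩⟩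
  omega

/-- If the number of alternations never exceeded `j + 1`, then by induction each copy would contain
all of them at some time, so that the erased sum would change between any two such times. But each
change is due to a pair that leaves the occurrence, and these pairs are bounded by heights. -/
theorem RePairing.exists_le_alternations {m : ℕ} {π τ : ℕ → ℕ} (h : RePairing σ m π τ)
    (hC : Even C) (hM : 2 * j + 1 ≤ M)
    (hocc : ∀ i < hardWordLen M C j, σ (a + i) = hardWord M C j i)
    (ham : a + hardWordLen M C j ≤ m) (hCa : 2 * (height σ a + ((M + 1) ^ j : ℕ)) + 2 ≤ C) :
    ∃ r, j + 1 ≤ alternations (τ · < r) a (a + hardWordLen M C j) := by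
  induction j generalizing a with
  | zero =>
    obtain ⟨i, hi, hi', hne⟩ : ∃ i, a ≤ i ∧ i + 1 < a + 4 ∧ τ i ≠ τ (i + 1) := by
      unfold hardWordLen at ham
      by_contra! heq
      have h₁ := heq a le_rfl (by omega)
      have h₂ := heq (a + 1) (by omega) (by omega)
      have := h.time_inj a (by omega) (a + 1) (by omega) h₁
      have := h.time_inj a (by omega) (a + 1 + 1) (by omega) (h₁.trans h₂)
      omega
    exact ⟨_, alternations_pos_of_ne hi hi' hne⟩
  | succ j ih =>
    have hpow : (((M + 1) ^ (j + 1) : ℕ) : ℤ) = (M * (M + 1) ^ j : ℕ) + ((M + 1) ^ j : ℕ) := by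
      push_cast; ring
    have hcopy : ∀ c < C, ∃ r, j + 1 ≤ alternations (τ · < r) (a + c * hardCellLen M C j)
        (a + c * hardCellLen M C j + hardWordLen M C j) := fun c hc => by
      refine ih (by omega) (occurrence_copy hocc hc) ((end_copy_le a hc).trans ham) ?_
      rw [height_start_copy hC hocc hc]
      rcases Nat.mod_two_eq_zero_or_one c with h | h <;> rw [h] <;> omega
    choose! t ht using hcopy
    by_contra! hmax
    have hheight : 0 ≤ height σ a := by
      rw [← h.card_crossing (le_of_add_le_left ham)]
      exact Int.natCast_nonneg _
    have hpos : 0 < (M + 1) ^ (j + 1) := by positivity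
    obtain ⟨s, hs, hne⟩ := exists_strictMonoOn_erasedSum_ne (σ := σ) hC (by omega) (by omega) hocc
      ht fun r => Nat.le_of_lt_succ (hmax r)
    have hchanges := h.card_changes_le (Nat.le_add_right _ _) ham hs hne
    rw [height_add_of_eq hocc, height_hardWordLen hC] at hchanges
    omega

end HardWord

/-! ### Re-pairings from window counts -/

section Hall

theorem exists_injOn_of_card_le_card_biUnion {ι α : Type*} [DecidableEq α] [Nonempty α]
    {s : Finset ι} {t : ι → Finset α} (h : ∀ u ⊆ s, #u ≤ #(u.biUnion t)) :
    ∃ f : ι → α, Set.InjOn f s ∧ ∀ i ∈ s, f i ∈ t i := by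
  classical
  obtain ⟨f, hf, hft⟩ := (Finset.all_card_le_biUnion_card_iff_exists_injective
    fun i : s => t i).1 fun u => by
      have := h (u.map (Function.Embedding.subtype _)) (Finset.map_subtype_subset u)
      rwa [Finset.card_map, Finset.map_eq_image, Finset.image_biUnion] at this
  refine ⟨fun i => if hi : i ∈ s then f ⟨i, hi⟩ else Classical.arbitrary α, fun i hi j hj hij => ?_,
    fun i hi => by simpa [hi] using hft ⟨i, hi⟩⟩
  simp only [dif_pos (Finset.mem_coe.1 hi), dif_pos (Finset.mem_coe.1 hj)] at hij
  exact congrArg Subtype.val (hf hij)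

variable {σ : ℕ → ℤ} {m : ℕ}

theorem sum_sign_mul {s : Finset ℕ} (hσ : ∀ i ∈ s, σ i = 1 ∨ σ i = -1) (x : ℕ → ℕ) :
    ∑ i ∈ s, σ i * x i =
      (∑ i ∈ s with σ i = 1, x i : ℕ) - (∑ i ∈ s with σ i = -1, x i : ℕ) := by
  simp only [Finset.sum_filter, Nat.cast_sum, ← Finset.sum_sub_distrib]
  refine Finset.sum_congr rfl fun i hi => ?_
  rcases hσ i hi with h | h <;> simp [h]

theorem exists_rePairing_of_bijOn (hσ : ∀ i < m, σ i = 1 ∨ σ i = -1) {f g : ℕ → ℕ}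
    (hf : Set.BijOn f {i | i < m ∧ σ i = 1} {i | i < m ∧ σ i = -1})
    (hlt : ∀ i < m, σ i = 1 → i < f i) (hg : Set.InjOn g {i | i < m ∧ σ i = 1}) :
    ∃ π τ, RePairing σ m π τ ∧ ∀ i < m, σ i = 1 → τ i = g i ∧ τ (f i) = g i := by
  set inv := Function.invFunOn f {i | i < m ∧ σ i = 1}
  have hclose : ∀ k < m, σ k = 1 → f k < m ∧ σ (f k) = -1 ∧ inv (f k) = k := fun k hk hk₁ =>
    ⟨(hf.mapsTo ⟨hk, hk₁⟩).1, (hf.mapsTo ⟨hk, hk₁⟩).2, hf.injOn.leftInvOn_invFunOn ⟨hk, hk₁⟩⟩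
  have hcases : ∀ i < m, ∃ k < m, σ k = 1 ∧ (i = k ∨ i = f k) := fun i hi => by
    rcases hσ i hi with h | h
    · exact ⟨i, hi, h, Or.inl rfl⟩
    · obtain ⟨k, ⟨hk, hk₁⟩, rfl⟩ := hf.surjOn ⟨hi, h⟩
      exact ⟨k, hk, hk₁, Or.inr rfl⟩
  set π : ℕ → ℕ := fun i => if σ i = 1 then f i else inv i with hπ
  set τ : ℕ → ℕ := fun i => if σ i = 1 then g i else g (inv i) with hτ
  have hpair : ∀ k < m, σ k = 1 →
      π k = f k ∧ π (f k) = k ∧ τ k = g k ∧ τ (f k) = g k := fun k hk hk₁ => by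
    obtain ⟨-, h₁, h₂⟩ := hclose k hk hk₁
    simp [hπ, hτ, hk₁, h₁, h₂]
  refine ⟨π, τ, ⟨fun i hi => ?_, fun i hi => ?_, fun i hi => ?_, fun i hi => ?_,
    fun i hi j hj hij => ?_⟩, fun i hi hi₁ => (hpair i hi hi₁).2.2⟩
  case refine_5 =>
    obtain ⟨k, hk, hk₁, hik⟩ := hcases i hi
    obtain ⟨l, hl, hl₁, hjl⟩ := hcases j hj
    obtain ⟨h₁, h₂, h₃, h₄⟩ := hpair k hk hk₁
    obtain ⟨-, -, h₃', h₄'⟩ := hpair l hl hl₁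
    obtain rfl : k = l := hg ⟨hk, hk₁⟩ ⟨hl, hl₁⟩ <| by
      rcases hik with rfl | rfl <;> rcases hjl with rfl | rfl <;> omega
    rcases hik with rfl | rfl <;> rcases hjl with rfl | rfl <;> omega
  all_goals
    obtain ⟨k, hk, hk₁, hik⟩ := hcases i hi
    have := hclose k hk hk₁
    have := hlt k hk hk₁
    obtain ⟨h₁, h₂, h₃, h₄⟩ := hpair k hk hk₁
    rcases hik with rfl | rfl
    all_goals simp only [h₁, h₂]
    all_goals omega

variable {N L e R : ℕ} {cnt : ℕ → ℕ → ℕ}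

/-- Let `x k` count the occurrences of some letters in a window. After the first occurrence of a
letter of `A` in the window, all the letters with a closing bracket are in `B`. -/
theorem sum_le_sum_add_of_closing_mem (hσ : ∀ i < m, σ i = 1 ∨ σ i = -1) {x : ℕ → ℕ}
    (he : ∀ k < m, ∑ i ∈ Finset.Ico k m, σ i * x i ≤ e) {A B : Finset ℕ}
    (hA : ∀ k ∈ A, k < m ∧ σ k = 1)
    (hB : ∀ k ∈ A, ∀ l < m, σ l = -1 → k < l → 0 < x k → 0 < x l → l ∈ B) :
    ∑ k ∈ A, x k ≤ ∑ l ∈ B, x l + e := by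
  rcases {k ∈ A | 0 < x k}.eq_empty_or_nonempty with hempty | hne
  · have hzero : ∀ k ∈ A, x k = 0 := by simpa [Finset.filter_eq_empty_iff] using hempty
    simp [Finset.sum_eq_zero hzero]
  set k₀ := {k ∈ A | 0 < x k}.min' hne with hk₀
  obtain ⟨hk₀A, hk₀x⟩ := Finset.mem_filter.1 ({k ∈ A | 0 < x k}.min'_mem hne)
  rw [← hk₀] at hk₀A hk₀x
  have hbal := he k₀ (hA k₀ hk₀A).1
  rw [sum_sign_mul fun i hi => hσ i (Finset.mem_Ico.1 hi).2] at hbal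
  have hopen : ∑ k ∈ A, x k ≤ ∑ k ∈ Finset.Ico k₀ m with σ k = 1, x k := by
    refine Finset.sum_le_sum_of_ne_zero fun k hk hx => ?_
    have hmin : k₀ ≤ k := Finset.min'_le _ _ (by simp [hk, Nat.pos_of_ne_zero hx])
    simp [hmin, hA k hk]
  have hclosing : ∑ l ∈ Finset.Ico k₀ m with σ l = -1, x l ≤ ∑ l ∈ B, x l := by
    refine Finset.sum_le_sum_of_ne_zero fun l hl hx => ?_
    simp only [Finset.mem_filter, Finset.mem_Ico] at hl
    refine hB k₀ hk₀A l hl.1.2 hl.2 (lt_of_le_of_ne hl.1.1 ?_) hk₀x (Nat.pos_of_ne_zero hx)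
    rintro h
    have := (hA k₀ hk₀A).2
    rw [h] at this
    omega
  omega

/-- The windows `r < R` in which both `k` and `l` occur, where `cnt r k` counts the occurrences of
`k` in the window `r`. -/
def commonWindows (cnt : ℕ → ℕ → ℕ) (R k l : ℕ) : Finset ℕ :=
  {r ∈ Finset.range R | 0 < cnt r k ∧ 0 < cnt r l}

/-- The windows in which two symbols of the word occur that have at most `m` common windows. -/
def rareWindows (cnt : ℕ → ℕ → ℕ) (R m : ℕ) : Finset ℕ :=
  {x ∈ Finset.range m ×ˢ Finset.range m | #(commonWindows cnt R x.1 x.2) ≤ m}.biUnion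
    fun x => commonWindows cnt R x.1 x.2

theorem card_rareWindows_le : #(rareWindows cnt R m) ≤ m ^ 3 := by
  calc #(rareWindows cnt R m) ≤ _ * m :=
        Finset.card_biUnion_le_card_mul _ _ m fun x hx => (Finset.mem_filter.1 hx).2
    _ ≤ #(Finset.range m ×ˢ Finset.range m) * m :=
        Nat.mul_le_mul_right m (Finset.card_filter_le _ _)
    _ = m ^ 3 := by rw [Finset.card_product, Finset.card_range]; ring

theorem card_le_card_of_closing_mem (hσ : ∀ i < m, σ i = 1 ∨ σ i = -1)
    (hN : ∀ k < m, ∑ r ∈ Finset.range R, cnt r k = N)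
    (hL : ∀ r < R, ∑ k ∈ Finset.range m, cnt r k ≤ L)
    (he : ∀ r < R, ∀ k < m, ∑ i ∈ Finset.Ico k m, σ i * cnt r i ≤ e)
    (hbig : e * R + m ^ 3 * L < N) {A B : Finset ℕ} (hA : ∀ k ∈ A, k < m ∧ σ k = 1)
    (hBm : ∀ l ∈ B, l < m)
    (hB : ∀ k ∈ A, ∀ l < m, σ l = -1 → k < l → m < #(commonWindows cnt R k l) → l ∈ B) :
    #A ≤ #B := by
  have hwindow : ∀ r ∈ Finset.range R, ∑ k ∈ A, cnt r k ≤
      ∑ l ∈ B, cnt r l + (e + if r ∈ rareWindows cnt R m then L else 0) := fun r hr => by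
    have hrR := Finset.mem_range.1 hr
    split_ifs with hrare
    · have : ∑ k ∈ A, cnt r k ≤ ∑ k ∈ Finset.range m, cnt r k :=
        Finset.sum_le_sum_of_subset fun k hk => Finset.mem_range.2 (hA k hk).1
      have := hL r hrR
      omega
    · refine sum_le_sum_add_of_closing_mem hσ (he r hrR) hA fun k hk l hl hσl hkl hxk hxl =>
        hB k hk l hl hσl hkl (not_le.1 fun hfew => hrare ?_)
      refine Finset.mem_biUnion.2 ⟨(k, l), Finset.mem_filter.2 ⟨?_, hfew⟩, ?_⟩
      · exact Finset.mk_mem_product (Finset.mem_range.2 (hA k hk).1) (Finset.mem_range.2 hl)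
      · exact Finset.mem_filter.2 ⟨hr, hxk, hxl⟩
  have hsum : #A * N ≤ #B * N + (R * e + #{r ∈ Finset.range R | r ∈ rareWindows cnt R m} * L) := by
    have := Finset.sum_le_sum hwindow
    rw [Finset.sum_comm, Finset.sum_add_distrib, Finset.sum_comm (t := B), Finset.sum_add_distrib,
      Finset.sum_congr rfl fun k hk => hN k (hA k hk).1,
      Finset.sum_congr rfl fun k hk => hN k (hBm k hk), ← Finset.sum_filter] at this
    simpa only [Finset.sum_const, smul_eq_mul, Finset.card_range] using this
  have hrare : #{r ∈ Finset.range R | r ∈ rareWindows cnt R m} * L ≤ m ^ 3 * L :=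
    Nat.mul_le_mul_right L <| (Finset.card_le_card fun r hr => (Finset.mem_filter.1 hr).2).trans
      card_rareWindows_le
  by_contra! hlt
  have := Nat.mul_le_mul_right N (Nat.succ_le_of_lt hlt)
  nlinarith

theorem exists_bijOn_of_window_counts (hσ : ∀ i < m, σ i = 1 ∨ σ i = -1) (h₀ : height σ m = 0)
    (hN : ∀ k < m, ∑ r ∈ Finset.range R, cnt r k = N)
    (hL : ∀ r < R, ∑ k ∈ Finset.range m, cnt r k ≤ L)
    (he : ∀ r < R, ∀ k < m, ∑ i ∈ Finset.Ico k m, σ i * cnt r i ≤ e)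
    (hbig : e * R + m ^ 3 * L < N) :
    ∃ f : ℕ → ℕ, Set.BijOn f {i | i < m ∧ σ i = 1} {i | i < m ∧ σ i = -1} ∧
      ∀ i < m, σ i = 1 → i < f i ∧ m < #(commonWindows cnt R i (f i)) := by
  have hcard : #{i ∈ Finset.range m | σ i = -1} = #{i ∈ Finset.range m | σ i = 1} := by
    have := sum_sign_mul (s := Finset.range m) (fun i hi => hσ i (Finset.mem_range.1 hi)) 1
    simp only [Pi.one_apply, Nat.cast_one, mul_one, ← Finset.card_eq_sum_ones] at this
    rw [height] at h₀
    omega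
  obtain ⟨f, hf, hfN⟩ := exists_injOn_of_card_le_card_biUnion (s := {i ∈ Finset.range m | σ i = 1})
    (t := fun k => {l ∈ Finset.range m | σ l = -1 ∧ k < l ∧ m < #(commonWindows cnt R k l)})
    fun u hu => card_le_card_of_closing_mem hσ hN hL he hbig
      (fun k hk => by simpa using hu hk)
      (fun l hl => by
        obtain ⟨k, -, hl⟩ := Finset.mem_biUnion.1 hl
        exact Finset.mem_range.1 (Finset.mem_filter.1 hl).1)
      (fun k hk l hl hσl hkl hcommon => Finset.mem_biUnion.2 ⟨k, hk, by simp [*]⟩)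
  simp only [Finset.mem_filter, Finset.mem_range, and_imp] at hfN
  have hmaps : Set.MapsTo f ({i ∈ Finset.range m | σ i = 1} : Finset ℕ)
      ({i ∈ Finset.range m | σ i = -1} : Finset ℕ) := fun k hk => by
    have hk := Finset.mem_filter.1 (Finset.mem_coe.1 hk)
    have hfk := hfN k (Finset.mem_range.1 hk.1) hk.2
    exact Finset.mem_coe.2 (Finset.mem_filter.2 ⟨Finset.mem_range.2 hfk.1, hfk.2.1⟩)
  have hbij : Set.BijOn f _ _ := ⟨hmaps, hf, Finset.surjOn_of_injOn_of_card_le f hmaps hf hcard.le⟩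
  exact ⟨f, by simpa using hbij, fun k hk hk₁ => (hfN k hk hk₁).2.2⟩

/-- Hall's theorem is applied twice: first to choose, for each opening bracket, a closing bracket
with more than `m` common windows, and then to choose distinct windows for the pairs. -/
theorem exists_rePairing_of_window_counts (hσ : ∀ i < m, σ i = 1 ∨ σ i = -1)
    (h₀ : height σ m = 0)
    (hN : ∀ k < m, ∑ r ∈ Finset.range R, cnt r k = N)
    (hL : ∀ r < R, ∑ k ∈ Finset.range m, cnt r k ≤ L)
    (he : ∀ r < R, ∀ k < m, ∑ i ∈ Finset.Ico k m, σ i * cnt r i ≤ e)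
    (hbig : e * R + m ^ 3 * L < N) :
    ∃ π τ, RePairing σ m π τ ∧ ∀ k < m, τ k < R ∧ 0 < cnt (τ k) k := by
  obtain ⟨f, hf, hfcommon⟩ := exists_bijOn_of_window_counts hσ h₀ hN hL he hbig
  obtain ⟨g, hg, hgcommon⟩ := exists_injOn_of_card_le_card_biUnion
    (s := {i ∈ Finset.range m | σ i = 1}) (t := fun k => commonWindows cnt R k (f k))
    fun u hu => by
      rcases u.eq_empty_or_nonempty with rfl | ⟨k, hk⟩
      · simp
      · have hkm := Finset.mem_filter.1 (hu hk)
        calc #u ≤ m := (Finset.card_le_card (hu.trans (Finset.filter_subset _ _))).trans_eq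
              (Finset.card_range m)
          _ ≤ #(commonWindows cnt R k (f k)) := (hfcommon k (Finset.mem_range.1 hkm.1) hkm.2).2.le
          _ ≤ _ := Finset.card_le_card
              (Finset.subset_biUnion_of_mem (fun k => commonWindows cnt R k (f k)) hk)
  simp only [commonWindows, Finset.mem_filter, Finset.mem_range, and_imp] at hgcommon
  obtain ⟨π, τ, hπτ, hτ⟩ := exists_rePairing_of_bijOn hσ hf
    (fun i hi hi₁ => (hfcommon i hi hi₁).1) (by simpa using hg)
  refine ⟨π, τ, hπτ, fun k hk => ?_⟩
  rcases hσ k hk with h | h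
  · rw [(hτ k hk h).1]
    exact ⟨(hgcommon k hk h).1, (hgcommon k hk h).2.1⟩
  · obtain ⟨l, ⟨hl, hl₁⟩, rfl⟩ := hf.surjOn ⟨hk, h⟩
    rw [(hτ l hl hl₁).2]
    exact ⟨(hgcommon l hl hl₁).1, (hgcommon l hl hl₁).2.2⟩

end Hall

/-! ### Chains with prescribed parities -/

section Chain

variable {n m Q N : ℕ} {σ : ℕ → ℤ}

/-- The number of the `k`-th node of a chain from `0` to `n - 1` with `m` inner nodes. The inner
node `k + 1` lies in the block `k` of length `2 * Q`; it is even if and only if `σ k = 1`, and `x k`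
selects it among the `Q` candidates of this parity. -/
def chainNodeVal (n : ℕ) (σ : ℕ → ℤ) (x : Fin m → Fin Q) : ℕ → ℕ
  | 0 => 0
  | k + 1 => if h : k < m then 2 + 2 * Q * k + 2 * (x ⟨k, h⟩ : ℕ) + if σ k = 1 then 0 else 1
      else n - 1

theorem chainNodeVal_inner_mem_Ico (x : Fin m → Fin Q) {k : ℕ} (hk : k < m) :
    chainNodeVal n σ x (k + 1) ∈ Set.Ico (2 + 2 * Q * k) (2 + 2 * Q * (k + 1)) := by
  have hx := (x ⟨k, hk⟩).2
  have hsucc : 2 * Q * (k + 1) = 2 * Q * k + 2 * Q := Nat.mul_succ _ _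
  simp only [chainNodeVal, dif_pos hk]
  split_ifs <;> constructor <;> omega

theorem chainNodeVal_last (x : Fin m → Fin Q) : chainNodeVal n σ x (m + 1) = n - 1 := by
  simp [chainNodeVal]

theorem chainNodeVal_lt_of_lt (hn : 2 * Q * m + 3 ≤ n) (x y : Fin m → Fin Q) {k l : ℕ}
    (hkl : k < l) (hl : l ≤ m + 1) : chainNodeVal n σ x k < chainNodeVal n σ y l := by
  obtain ⟨l, rfl⟩ : ∃ l', l = l' + 1 := ⟨l - 1, by omega⟩
  have hupp : chainNodeVal n σ x k < 2 + 2 * Q * l := by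
    rcases k with _ | k
    · exact Nat.add_pos_left two_pos _
    · have hblock := (chainNodeVal_inner_mem_Ico (n := n) (σ := σ) x (k := k) (by omega)).2
      exact hblock.trans_le (Nat.add_le_add_left (Nat.mul_le_mul_left _ (by omega)) 2)
  rcases Nat.lt_or_ge l m with hlm | hlm
  · exact hupp.trans_le (chainNodeVal_inner_mem_Ico y hlm).1
  · obtain rfl : l = m := by omega
    rw [chainNodeVal_last]
    omega

theorem chainNodeVal_lt (hn : 2 * Q * m + 3 ≤ n) (x : Fin m → Fin Q) (k : ℕ) :
    chainNodeVal n σ x k < n := by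
  rcases Nat.lt_or_ge k (m + 1) with hk | hk
  · have := chainNodeVal_lt_of_lt (σ := σ) hn x x hk le_rfl
    rw [chainNodeVal_last] at this
    omega
  · obtain ⟨k, rfl⟩ : ∃ k', k = k' + 1 := ⟨k - 1, by omega⟩
    rw [chainNodeVal, dif_neg (by omega)]
    omega

/-- The `k`-th node of the chain that `x` selects, see `chainNodeVal`. -/
def chainNode (hn : 2 * Q * m + 3 ≤ n) (σ : ℕ → ℤ) (x : Fin m → Fin Q) (k : ℕ) : Fin n :=
  ⟨chainNodeVal n σ x k, chainNodeVal_lt hn x k⟩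

variable {hn : 2 * Q * m + 3 ≤ n} {x y : Fin m → Fin Q}

theorem chainNode_lt_of_lt (x y : Fin m → Fin Q) {k l : ℕ} (hkl : k < l) (hl : l ≤ m + 1) :
    chainNode hn σ x k < chainNode hn σ y l :=
  chainNodeVal_lt_of_lt hn x y hkl hl

theorem chainNode_le_chainNode_iff {k l : ℕ} (hk : k ≤ m + 1) (hl : l ≤ m + 1) :
    chainNode hn σ x k ≤ chainNode hn σ x l ↔ k ≤ l := by
  rcases Nat.lt_or_ge l k with hlt | hle
  · exact iff_of_false (chainNode_lt_of_lt x x hlt hk).not_ge hlt.not_ge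
  · refine iff_of_true ?_ hle
    rcases hle.eq_or_lt with rfl | hlt
    exacts [le_rfl, (chainNode_lt_of_lt x x hlt hl).le]

theorem eq_of_chainNode_eq {k l : ℕ} (hk : k ≤ m + 1) (hl : l ≤ m + 1)
    (h : chainNode hn σ x k = chainNode hn σ y l) : k = l := by
  rcases Nat.lt_trichotomy k l with hlt | heq | hgt
  · exact absurd h (chainNode_lt_of_lt x y hlt hl).ne
  · exact heq
  · exact absurd h (chainNode_lt_of_lt y x hgt hk).ne'

theorem apply_eq_of_chainNode_succ_eq {k : Fin m}
    (h : chainNode hn σ x (k + 1) = chainNode hn σ y (k + 1)) : x k = y k := by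
  have := congrArg Fin.val h
  simp only [chainNode, chainNodeVal, k.2, dif_pos, Fin.eta] at this
  ext
  omega

theorem neg_one_pow_chainNode_succ {k : ℕ} (hk : k < m) (hσ : σ k = 1 ∨ σ k = -1) :
    (-1 : ℤ) ^ (chainNode hn σ x (k + 1) : ℕ) = σ k := by
  simp only [chainNode, chainNodeVal, dif_pos hk]
  rcases hσ with h | h
  · rw [if_pos h, h]
    exact Even.neg_one_pow ⟨1 + Q * k + x ⟨k, hk⟩, by ring⟩
  · rw [if_neg (by omega), h]
    exact Odd.neg_one_pow ⟨1 + Q * k + x ⟨k, hk⟩, by ring⟩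

open Classical in
/-- The vector in `U_n` of the chain that `x` selects, in which the letters `a_i` of the inner nodes
`i` of the chain have multiplicity `N`. -/
noncomputable def chainVec (hn : 2 * Q * m + 3 ≤ n) (σ : ℕ → ℤ) (x : Fin m → Fin Q) (N : ℕ) :
    UnivLetter n → ℕ :=
  Sum.elim
    (fun e => if ∃ k ≤ m, chainNode hn σ x k = e.1.1 ∧ chainNode hn σ x (k + 1) = e.1.2
      then 1 else 0)
    (fun i => if ∃ k < m, chainNode hn σ x (k + 1) = i then N else 0)

theorem chainVec_letterC_le_one {i j : Fin n} {h : i < j} :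
    chainVec hn σ x N (letterC i j h) ≤ 1 := by
  simp only [chainVec, letterC, Sum.elim_inl]
  split_ifs <;> simp

theorem chainVec_letterC_pos_iff {i j : Fin n} {h : i < j} :
    0 < chainVec hn σ x N (letterC i j h) ↔
      ∃ k ≤ m, chainNode hn σ x k = i ∧ chainNode hn σ x (k + 1) = j := by
  simp only [chainVec, letterC, Sum.elim_inl]
  split_ifs with hedge <;> simp [hedge]

theorem chainVec_letterC_eq_one_iff {i j : Fin n} {h : i < j} :
    chainVec hn σ x N (letterC i j h) = 1 ↔
      ∃ k ≤ m, chainNode hn σ x k = i ∧ chainNode hn σ x (k + 1) = j := by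
  rw [← chainVec_letterC_pos_iff (N := N) (h := h)]
  have := chainVec_letterC_le_one (hn := hn) (σ := σ) (x := x) (N := N) (h := h)
  omega

theorem chainVec_letterA_chainNode {k : ℕ} (hk : k < m) :
    chainVec hn σ x N (letterA (chainNode hn σ x (k + 1))) = N :=
  if_pos ⟨k, hk, rfl⟩

theorem exists_of_chainVec_letterA_ne_zero {i : Fin n}
    (h : chainVec hn σ x N (letterA i) ≠ 0) : ∃ k < m, chainNode hn σ x (k + 1) = i := by
  by_contra hnone
  exact h (if_neg hnone)

theorem sum_neg_one_pow_mul_eq_sum_chainNode (hσ : ∀ k < m, σ k = 1 ∨ σ k = -1)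
    {f : Fin n → ℤ} (hf : ∀ i, f i ≠ 0 → ∃ k < m, chainNode hn σ x (k + 1) = i)
    (T : Finset (Fin n)) :
    ∑ i ∈ T, (-1 : ℤ) ^ (i : ℕ) * f i =
      ∑ k ∈ Finset.range m with chainNode hn σ x (k + 1) ∈ T,
        σ k * f (chainNode hn σ x (k + 1)) := by
  refine (Finset.sum_of_injOn (fun k => chainNode hn σ x (k + 1)) ?_ ?_ ?_ ?_).symm
  · intro k hk l hl heq
    simp only [Finset.coe_filter, Finset.mem_range, Set.mem_ofPred_eq] at hk hl
    have := eq_of_chainNode_eq (by omega) (by omega) heq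
    omega
  · exact fun k hk => (Finset.mem_filter.1 (Finset.mem_coe.1 hk)).2
  · intro i hi hout
    by_contra hne
    obtain ⟨k, hk, rfl⟩ := hf i (right_ne_zero_of_mul hne)
    exact hout ⟨k, by simpa using ⟨hk, hi⟩, rfl⟩
  · intro k hk
    have hkm := Finset.mem_range.1 (Finset.mem_filter.1 hk).1
    rw [neg_one_pow_chainNode_succ hkm (hσ k hkm)]

theorem sum_neg_one_pow_mul_chainVec (hσ : ∀ k < m, σ k = 1 ∨ σ k = -1) (T : Finset (Fin n)) :
    ∑ i ∈ T, (-1 : ℤ) ^ (i : ℕ) * (chainVec hn σ x N (letterA i) : ℤ) =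
      (∑ k ∈ Finset.range m with chainNode hn σ x (k + 1) ∈ T, σ k) * N := by
  rw [Finset.sum_mul, sum_neg_one_pow_mul_eq_sum_chainNode hσ fun i hi =>
    exists_of_chainVec_letterA_ne_zero (Nat.cast_ne_zero.1 hi)]
  refine Finset.sum_congr rfl fun k hk => ?_
  rw [chainVec_letterA_chainNode (Finset.mem_range.1 (Finset.mem_filter.1 hk).1)]

theorem exists_filter_range_eq_range {p : ℕ → Prop} [DecidablePred p] {m : ℕ}
    (hp : ∀ k l, k ≤ l → l < m → p l → p k) :
    ∃ l ≤ m, {k ∈ Finset.range m | p k} = Finset.range l := by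
  induction m with
  | zero => exact ⟨0, le_rfl, rfl⟩
  | succ m ih =>
    by_cases hm : p m
    · refine ⟨m + 1, le_rfl, Finset.filter_true_of_mem fun k hk => ?_⟩
      exact hp k m (Nat.le_of_lt_succ (Finset.mem_range.1 hk)) m.lt_succ_self hm
    · obtain ⟨l, hl, heq⟩ := ih fun k l hkl hl => hp k l hkl (by omega)
      refine ⟨l, by omega, ?_⟩
      rw [Finset.range_add_one, Finset.filter_insert, if_neg hm, heq]

theorem isChainVector_chainVec : IsChainVector (chainVec hn σ x N) := by
  refine ⟨fun i j h => Nat.le_one_iff_eq_zero_or_eq_one.1 chainVec_letterC_le_one,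
    m + 1, fun s => chainNode hn σ x s, fun s s' h => chainNode_lt_of_lt x x h (by omega), rfl, ?_,
    fun i j h => ?_⟩
  · simp only [chainNode, Fin.val_last, chainNodeVal_last]
    omega
  · rw [chainVec_letterC_eq_one_iff]
    exact ⟨fun ⟨k, hk, hedge⟩ => ⟨⟨k, by omega⟩, by simpa using hedge⟩,
      fun ⟨s, hs⟩ => ⟨s, by omega, by simpa using hs⟩⟩

theorem isBalanced_chainVec (hσ : IsDyck σ m) : IsBalanced (chainVec hn σ x N) := by
  refine ⟨?_, fun K _ => ?_⟩
  · rw [sum_neg_one_pow_mul_chainVec hσ.sign,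
      Finset.filter_true_of_mem fun k _ => Finset.mem_univ _]
    exact mul_eq_zero_of_left hσ.height_eq_zero _
  · obtain ⟨l, hl, hrange⟩ := exists_filter_range_eq_range (m := m)
      (p := fun k => chainNode hn σ x (k + 1) ∈ Finset.Iic K) fun k l hkl hlm hl => by
        rw [Finset.mem_Iic] at hl ⊢
        exact ((chainNode_le_chainNode_iff (by omega) (by omega)).2 (by omega)).trans hl
    rw [sum_neg_one_pow_mul_chainVec hσ.sign, hrange]
    exact mul_nonneg (hσ.height_nonneg l hl) (Int.natCast_nonneg N)

theorem isCompatible_chainVec : IsCompatible (chainVec hn σ x N) := by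
  intro j hj
  obtain ⟨k, hk, rfl⟩ := exists_of_chainVec_letterA_ne_zero hj.ne'
  have hedge : ∀ l ≤ m, ∃ h : chainNode hn σ x l < chainNode hn σ x (l + 1),
      chainVec hn σ x N (letterC _ _ h) = 1 := fun l hl =>
    ⟨chainNode_lt_of_lt x x l.lt_succ_self (by omega),
      chainVec_letterC_eq_one_iff.2 ⟨l, hl, rfl, rfl⟩⟩
  exact ⟨fun _ => ⟨_, hedge k hk.le⟩, fun _ => ⟨_, hedge (k + 1) hk⟩⟩

theorem chainVec_mem_universalOneCounterSet (hσ : IsDyck σ m) :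
    chainVec hn σ x N ∈ universalOneCounterSet n :=
  ⟨isChainVector_chainVec, isBalanced_chainVec hσ, isCompatible_chainVec⟩

end Chain

section Touches

variable {n : ℕ}

/-- The word `u` contains `a_i` or an edge at `i`, and therefore reveals that `i` is on the chain if
the Parikh image of `u` is completed to a vector in `U_n`. -/
def Touches (u : List (UnivLetter n)) (i : Fin n) : Prop :=
  letterA i ∈ u ∨ (∃ (j : Fin n) (h : i < j), letterC i j h ∈ u) ∨
    ∃ (j : Fin n) (h : j < i), letterC j i h ∈ u

theorem Touches.mono {u v : List (UnivLetter n)} (huv : u ⊆ v) {i : Fin n} (h : Touches u i) :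
    Touches v i := by
  rcases h with h | ⟨j, hj, h⟩ | ⟨j, hj, h⟩
  · exact Or.inl (huv h)
  · exact Or.inr (Or.inl ⟨j, hj, huv h⟩)
  · exact Or.inr (Or.inr ⟨j, hj, huv h⟩)

theorem mem_iff_parikhVector_pos {α : Type} [DecidableEq α] {w : List α} {a : α} :
    a ∈ w ↔ 0 < parikhVector w a :=
  List.count_pos_iff.symm

theorem Touches.exists_eq_of_path {w : List (UnivLetter n)} {i : Fin n} (hi : Touches w i)
    (hcomp : IsCompatible (parikhVector w)) {t : ℕ} {p : Fin (t + 1) → Fin n} (hp₀ : (p 0 : ℕ) = 0)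
    (hedge : ∀ i j h, letterC i j h ∈ w ↔ ∃ s : Fin t, p s.castSucc = i ∧ p s.succ = j) :
    ∃ s, p s = i := by
  rcases hi with ha | ⟨j, hj, hc⟩ | ⟨j, hj, hc⟩
  · rcases Nat.eq_zero_or_pos (i : ℕ) with hi₀ | hi₀
    · exact ⟨0, Fin.ext (hp₀.trans hi₀.symm)⟩
    · obtain ⟨j, hj, hc⟩ := (hcomp i (mem_iff_parikhVector_pos.1 ha)).1 hi₀
      obtain ⟨s, -, hs⟩ := (hedge j i hj).1 (mem_iff_parikhVector_pos.2 (by omega))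
      exact ⟨_, hs⟩
  · obtain ⟨s, hs, -⟩ := (hedge _ _ _).1 hc
    exact ⟨_, hs⟩
  · obtain ⟨s, -, hs⟩ := (hedge _ _ _).1 hc
    exact ⟨_, hs⟩

variable {m Q : ℕ} {hn : 2 * Q * m + 3 ≤ n} {σ : ℕ → ℤ}

theorem exists_chainNode_eq_of_path (x : Fin m → Fin Q) {t : ℕ} {p : Fin (t + 1) → Fin n}
    (hp₀ : (p 0 : ℕ) = 0) (hedge : ∀ s : Fin t, ∃ z, ∃ l ≤ m,
      chainNode hn σ z l = p s.castSucc ∧ chainNode hn σ z (l + 1) = p s.succ)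
    (s : Fin (t + 1)) : (s : ℕ) ≤ m + 1 ∧ ∃ z, p s = chainNode hn σ z s := by
  induction s using Fin.induction with
  | zero => exact ⟨Nat.zero_le _, x, Fin.ext hp₀⟩
  | succ s ih =>
    obtain ⟨hs, z, hz⟩ := ih
    obtain ⟨z', l, hl, hleft, hright⟩ := hedge s
    obtain rfl : l = s := eq_of_chainNode_eq (by omega) hs (hleft.trans hz)
    exact ⟨Nat.succ_le_succ hl, z', hright.symm⟩

theorem chainNode_eq_of_append_mem {x y : Fin m → Fin Q} {N N' : ℕ}
    {u u' v v' : List (UnivLetter n)} (hx : parikhVector (u ++ u') = chainVec hn σ x N)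
    (hy : parikhVector (v' ++ v) = chainVec hn σ y N')
    (hU : parikhVector (u ++ v) ∈ universalOneCounterSet n) {k : ℕ} (hk : k ≤ m + 1)
    (hu : Touches u (chainNode hn σ x k)) (hv : Touches v (chainNode hn σ y k)) :
    chainNode hn σ x k = chainNode hn σ y k := by
  obtain ⟨⟨hle, t, p, hmono, hp₀, -, hp⟩, -, hcomp⟩ := hU
  have hpath : ∀ i j h, letterC i j h ∈ u ++ v ↔ ∃ s : Fin t, p s.castSucc = i ∧ p s.succ = j :=
    fun i j h => by
      rw [← hp i j h, mem_iff_parikhVector_pos]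
      have := hle i j h
      omega
  have hnode := exists_chainNode_eq_of_path (hn := hn) (σ := σ) x hp₀ fun s => by
    have hlt := hmono (Fin.castSucc_lt_succ (i := s))
    rcases List.mem_append.1 ((hpath _ _ hlt).2 ⟨s, rfl, rfl⟩) with hmem | hmem
    · have hpos := mem_iff_parikhVector_pos.1 (List.mem_append_left u' hmem)
      exact ⟨x, chainVec_letterC_pos_iff.1 (hx ▸ hpos)⟩
    · have hpos := mem_iff_parikhVector_pos.1 (List.mem_append_right v' hmem)
      exact ⟨y, chainVec_letterC_pos_iff.1 (hy ▸ hpos)⟩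
  obtain ⟨s, hs⟩ :=
    (hu.mono (List.subset_append_left u v)).exists_eq_of_path hcomp hp₀ hpath
  obtain ⟨s', hs'⟩ :=
    (hv.mono (List.subset_append_right u v)).exists_eq_of_path hcomp hp₀ hpath
  obtain ⟨hsm, z, hz⟩ := hnode s
  obtain ⟨hsm', z', hz'⟩ := hnode s'
  have hsk := eq_of_chainNode_eq hsm hk (hz.symm.trans hs)
  have hsk' := eq_of_chainNode_eq hsm' hk (hz'.symm.trans hs')
  rw [← hs, ← hs', Fin.ext (hsk.trans hsk'.symm)]

end Touches

/-! ### Words, windows and runs -/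

section Window

variable {α : Type}

/-- The `r`-th factor of the word `w` when `w` is cut into factors of length `L`. -/
def window (w : List α) (L r : ℕ) : List α := (w.drop (r * L)).take L

theorem take_mul_append_window (w : List α) (L r : ℕ) :
    w.take (r * L) ++ window w L r = w.take ((r + 1) * L) := by
  rw [Nat.succ_mul, List.take_add, window]

theorem mem_take_of_mem_window {w : List α} {a : α} {L s r : ℕ} (hs : s < r)
    (ha : a ∈ window w L s) : a ∈ w.take (r * L) := by
  have hprefix := List.take_subset_take_left w (Nat.mul_le_mul_right L (Nat.succ_le_of_lt hs))
  exact hprefix (take_mul_append_window w L s ▸ List.mem_append_right _ ha)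

theorem mem_drop_of_mem_window {w : List α} {a : α} {L s r : ℕ} (hs : r ≤ s)
    (ha : a ∈ window w L s) : a ∈ w.drop (r * L) :=
  List.drop_subset_drop_left w (Nat.mul_le_mul_right L hs) (List.mem_of_mem_take ha)

variable [DecidableEq α]

theorem parikhVector_append (u v : List α) (a : α) :
    parikhVector (u ++ v) a = parikhVector u a + parikhVector v a :=
  List.count_append

theorem length_eq_sum_parikhVector [Fintype α] (w : List α) :
    w.length = ∑ a, parikhVector w a := by
  simpa [parikhVector] using
    (Multiset.sum_count_eq_card (m := (w : Multiset α)) fun a _ => Finset.mem_univ a).symm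

theorem sum_parikhVector_le_length (T : Finset α) (w : List α) :
    ∑ a ∈ T, parikhVector w a ≤ w.length :=
  calc ∑ a ∈ T, parikhVector w a ≤ ∑ a ∈ T ∪ w.toFinset, parikhVector w a :=
        Finset.sum_le_sum_of_subset Finset.subset_union_left
    _ = w.length := by
        simpa [parikhVector] using Multiset.sum_count_eq_card (s := T ∪ w.toFinset)
          (m := (w : Multiset α)) fun a ha => by simp_all

theorem sum_parikhVector_window (w : List α) (L R : ℕ) (a : α) :
    ∑ r ∈ Finset.range R, parikhVector (window w L r) a = parikhVector (w.take (R * L)) a := by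
  induction R with
  | zero => simp [parikhVector]
  | succ R ih =>
    rw [Finset.sum_range_succ, ih, ← parikhVector_append, take_mul_append_window]

end Window

section Run

variable {α S : Type} {M : NFA α S} {w : List α} {ρ : ℕ → S}

/-- `ρ i` is the state after the first `i` letters in an accepting run of `M` on `w`. Beyond the
length of `w` the run stays in its last state. -/
structure IsAcceptingRun (M : NFA α S) (w : List α) (ρ : ℕ → S) : Prop where
  mem_evalFrom_take : ∀ i, ρ i ∈ M.evalFrom M.start (w.take i)
  drop_mem_acceptsFrom : ∀ i, w.drop i ∈ M.acceptsFrom {ρ i}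
  mem_evalFrom_take_drop : ∀ i l, ρ (i + l) ∈ M.evalFrom {ρ i} ((w.drop i).take l)

theorem mem_evalFrom_append_of_mem {T : Set S} {u v : List α} {q q' : S}
    (hu : q ∈ M.evalFrom T u) (hv : q' ∈ M.evalFrom {q} v) : q' ∈ M.evalFrom T (u ++ v) := by
  rw [NFA.evalFrom_append]
  exact NFA.mem_evalFrom_iff_exists.2 ⟨q, hu, hv⟩

theorem append_mem_accepts_of_mem {u v : List α} {q : S} (hu : q ∈ M.evalFrom M.start u)
    (hv : v ∈ M.acceptsFrom {q}) : u ++ v ∈ M.accepts := by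
  obtain ⟨s, hs, hqs⟩ := hv
  exact ⟨s, hs, mem_evalFrom_append_of_mem hu hqs⟩

theorem exists_states_of_mem_evalFrom {q q' : S} (h : q' ∈ M.evalFrom {q} w) :
    ∃ ρ : ℕ → S, ρ 0 = q ∧ (∀ i, w.length ≤ i → ρ i = q') ∧
      ∀ i l, ρ (i + l) ∈ M.evalFrom {ρ i} ((w.drop i).take l) := by
  induction w generalizing q with
  | nil => exact ⟨fun _ => q, rfl, fun _ _ => (Set.mem_singleton_iff.1 h).symm, fun i l => by simp⟩
  | cons a w ih =>
    rw [NFA.evalFrom_cons, NFA.stepSet_singleton, NFA.mem_evalFrom_iff_exists] at h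
    obtain ⟨q₁, hq₁, h⟩ := h
    obtain ⟨ρ, h₀, hend, hρ⟩ := ih h
    refine ⟨fun i => Nat.casesOn i q ρ, rfl, fun i hi => ?_, fun i l => ?_⟩
    · obtain ⟨i, rfl⟩ := Nat.exists_eq_add_of_lt (Nat.zero_lt_of_lt hi)
      exact hend _ (by simpa using hi)
    · rcases i with _ | i
      · rcases l with _ | l
        · simp
        · have hl := hρ 0 l
          rw [h₀, List.drop_zero, Nat.zero_add] at hl
          rw [List.drop_zero, List.take_succ_cons, NFA.evalFrom_cons, NFA.stepSet_singleton,
            Nat.zero_add]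
          exact NFA.mem_evalFrom_iff_exists.2 ⟨q₁, hq₁, hl⟩
      · simpa only [Nat.succ_add, List.drop_succ_cons] using hρ i l

theorem exists_isAcceptingRun (hw : w ∈ M.accepts) : ∃ ρ, IsAcceptingRun M w ρ := by
  obtain ⟨s, hs, hw⟩ := NFA.mem_accepts.1 hw
  obtain ⟨q, hq, hw⟩ := NFA.mem_evalFrom_iff_exists.1 hw
  obtain ⟨ρ, rfl, hend, hρ⟩ := exists_states_of_mem_evalFrom hw
  refine ⟨ρ, fun i => ?_, fun i => ⟨s, hs, ?_⟩, hρ⟩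
  · exact NFA.mem_evalFrom_iff_exists.2 ⟨_, hq, by simpa using hρ 0 i⟩
  · have := hρ i w.length
    rwa [hend _ (Nat.le_add_left _ _), List.take_of_length_le (by simp)] at this

theorem exists_bound_exists_length_le [Finite S] (P : S → List α → Prop) :
    ∃ e : ℕ, ∀ q w, P q w → ∃ w', P q w' ∧ w'.length ≤ e := by
  choose! f hf using fun (q : S) (h : ∃ w, P q w) => h
  obtain ⟨e, he⟩ := (Set.finite_range fun q => (f q).length).bddAbove
  exact ⟨e, fun q w hw => ⟨f q, hf q ⟨w, hw⟩, he ⟨q, rfl⟩⟩⟩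

theorem exists_bound_completion [Finite S] (M : NFA α S) :
    ∃ e : ℕ, ∀ w ρ, IsAcceptingRun M w ρ → ∀ i l, ∃ u v,
      u ++ (w.drop i).take l ++ v ∈ M.accepts ∧ u.length + v.length ≤ e := by
  obtain ⟨e₁, he₁⟩ := exists_bound_exists_length_le fun q u => q ∈ M.evalFrom M.start u
  obtain ⟨e₂, he₂⟩ := exists_bound_exists_length_le fun q v => v ∈ M.acceptsFrom {q}
  refine ⟨e₁ + e₂, fun w ρ hρ i l => ?_⟩
  obtain ⟨u, hu, hlu⟩ := he₁ (ρ i) _ (hρ.mem_evalFrom_take i)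
  obtain ⟨v, hv, hlv⟩ := he₂ (ρ (i + l)) _ (hρ.drop_mem_acceptsFrom (i + l))
  exact ⟨u, v, append_mem_accepts_of_mem
    (mem_evalFrom_append_of_mem hu (hρ.mem_evalFrom_take_drop i l)) hv, Nat.add_le_add hlu hlv⟩

end Run

section Balance

variable {n m Q N : ℕ} {σ : ℕ → ℤ}

theorem sum_Ici_neg_one_pow_mul_nonpos {v : UnivLetter n → ℕ} (hv : IsBalanced v) {k : Fin n}
    (hk : 0 < (k : ℕ)) :
    ∑ i ∈ Finset.Ici k, (-1 : ℤ) ^ (i : ℕ) * (v (letterA i) : ℤ) ≤ 0 := by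
  obtain ⟨hsum, hprefix⟩ := hv
  have hkn := k.2
  have hpred := hprefix ⟨k - 1, by omega⟩ (by simp only; omega)
  have hcompl : (Finset.Ici k)ᶜ = Finset.Iic ⟨k - 1, by omega⟩ := by
    ext i
    simp only [Finset.mem_compl, Finset.mem_Ici, Finset.mem_Iic, Fin.le_def]
    omega
  rw [← Finset.sum_add_sum_compl (Finset.Ici k), hcompl] at hsum
  linarith

theorem neg_length_le_sum_neg_one_pow_mul (u : List (UnivLetter n)) (T : Finset (Fin n)) :
    -(u.length : ℤ) ≤ ∑ i ∈ T, (-1 : ℤ) ^ (i : ℕ) * (parikhVector u (letterA i) : ℤ) := by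
  have hlen : ∑ i ∈ T, parikhVector u (letterA i) ≤ u.length := by
    have := sum_parikhVector_le_length (T.map ⟨letterA, Sum.inr_injective⟩) u
    rwa [Finset.sum_map] at this
  calc -(u.length : ℤ) ≤ ∑ i ∈ T, -(parikhVector u (letterA i) : ℤ) := by
        rw [Finset.sum_neg_distrib, neg_le_neg_iff]
        exact_mod_cast hlen
    _ ≤ _ := Finset.sum_le_sum fun i _ => by
        rcases neg_one_pow_eq_or ℤ (i : ℕ) with h | h <;> rw [h] <;> omega

theorem sum_Ico_mul_parikhVector_le {hn : 2 * Q * m + 3 ≤ n} (hσ : ∀ k < m, σ k = 1 ∨ σ k = -1)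
    {x : Fin m → Fin Q} {u z v : List (UnivLetter n)} {e : ℕ}
    (hU : IsBalanced (parikhVector (u ++ z ++ v))) (hlen : u.length + v.length ≤ e)
    (hz : ∀ i, letterA i ∈ z → ∃ k < m, chainNode hn σ x (k + 1) = i) {l : ℕ} (hl : l < m) :
    ∑ k ∈ Finset.Ico l m, σ k * parikhVector z (letterA (chainNode hn σ x (k + 1))) ≤ e := by
  obtain ⟨T, hT⟩ : ∃ T, T = Finset.Ici (chainNode hn σ x (l + 1)) := ⟨_, rfl⟩
  have hpos : 0 < (chainNode hn σ x (l + 1) : ℕ) :=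
    Nat.zero_lt_of_lt (chainNode_lt_of_lt (hn := hn) (σ := σ) x x (Nat.succ_pos l) (by omega))
  have hrange :
      {k ∈ Finset.range m | chainNode hn σ x (k + 1) ∈ T} = Finset.Ico l m := by
    ext k
    simp only [hT, Finset.mem_filter, Finset.mem_range, Finset.mem_Ici, Finset.mem_Ico]
    constructor
    · rintro ⟨hk, hle⟩
      exact ⟨by simpa using (chainNode_le_chainNode_iff (by omega) (by omega)).1 hle, hk⟩
    · rintro ⟨hlk, hk⟩
      exact ⟨hk, (chainNode_le_chainNode_iff (by omega) (by omega)).2 (by omega)⟩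
  have hsum := sum_Ici_neg_one_pow_mul_nonpos hU hpos
  rw [← hT] at hsum
  simp only [parikhVector_append, Nat.cast_add, mul_add, Finset.sum_add_distrib] at hsum
  rw [sum_neg_one_pow_mul_eq_sum_chainNode (f := fun i => (parikhVector z (letterA i) : ℤ)) hσ
    fun i hi => hz i (mem_iff_parikhVector_pos.2 (Nat.pos_of_ne_zero (Nat.cast_ne_zero.1 hi))),
    hrange] at hsum
  have hu := neg_length_le_sum_neg_one_pow_mul u T
  have hv := neg_length_le_sum_neg_one_pow_mul v T
  omega

theorem length_le_of_parikhVector_eq_chainVec {hn : 2 * Q * m + 3 ≤ n} {x : Fin m → Fin Q}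
    {w : List (UnivLetter n)} (hw : parikhVector w = chainVec hn σ x N) :
    w.length ≤ n * n + n * N := by
  rw [length_eq_sum_parikhVector, hw, Fintype.sum_sum_type]
  refine Nat.add_le_add ?_ ?_
  · calc _ ≤ ∑ _ : {p : Fin n × Fin n // p.1 < p.2}, 1 :=
          Finset.sum_le_sum fun a _ => chainVec_letterC_le_one (h := a.2)
      _ ≤ n * n := by
          rw [← Finset.card_eq_sum_ones, Finset.card_univ]
          exact (Fintype.card_subtype_le _).trans_eq (by simp)
  · calc _ ≤ ∑ _ : Fin n, N := Finset.sum_le_sum fun i _ => by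
          simp only [chainVec, Sum.elim_inr]
          split_ifs <;> omega
      _ = n * N := by simp

end Balance

/-! ### The lower bound for automata -/

section LowerBound

variable {n m Q N : ℕ} {σ : ℕ → ℤ} {hn : 2 * Q * m + 3 ≤ n} {x : Fin m → Fin Q}

theorem exists_window_parameters (n e a : ℕ) :
    ∃ L N R : ℕ, n * n + n * N ≤ R * L ∧ e * R + a * L < N := by
  obtain ⟨L, hL⟩ : ∃ L, L = e * n + 1 := ⟨_, rfl⟩
  obtain ⟨K, hK⟩ : ∃ K, K = e * (n * n) + a * L + 1 := ⟨_, rfl⟩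
  refine ⟨L, K * L, n * n + n * K, ?_, ?_⟩
  · calc n * n + n * (K * L) ≤ n * n * L + n * (K * L) :=
          Nat.add_le_add_right (Nat.le_mul_of_pos_right _ (by omega)) _
      _ = (n * n + n * K) * L := by ring
  · calc e * (n * n + n * K) + a * L < e * n * K + K := by
          rw [hK]
          ring_nf
          omega
      _ = K * L := by rw [hL]; ring

theorem exists_rePairing_of_parikhVector_eq_chainVec (hσ : IsDyck σ m) {w : List (UnivLetter n)}
    (hw : parikhVector w = chainVec hn σ x N) {e L R : ℕ}
    (hbal : ∀ r, ∃ u v, IsBalanced (parikhVector (u ++ window w L r ++ v)) ∧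
      u.length + v.length ≤ e)
    (hlen : n * n + n * N ≤ R * L) (hbig : e * R + m ^ 3 * L < N) :
    ∃ π τ, RePairing σ m π τ ∧
      ∀ k < m, letterA (chainNode hn σ x (k + 1)) ∈ window w L (τ k) := by
  obtain ⟨π, τ, hπτ, hτ⟩ := exists_rePairing_of_window_counts
    (cnt := fun r k => parikhVector (window w L r) (letterA (chainNode hn σ x (k + 1))))
    hσ.sign hσ.height_eq_zero
    (fun k hk => by
      have hwlen := (length_le_of_parikhVector_eq_chainVec hw).trans hlen
      rw [sum_parikhVector_window, List.take_of_length_le hwlen, hw,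
        chainVec_letterA_chainNode hk])
    (fun r _ => by
      have hinj : Set.InjOn (fun k => letterA (chainNode hn σ x (k + 1))) (Finset.range m) :=
        fun k hk l hl heq => by
          rw [Finset.coe_range, Set.mem_Iio] at hk hl
          have := eq_of_chainNode_eq (by omega) (by omega) (Sum.inr_injective heq)
          omega
      rw [← Finset.sum_image (f := parikhVector (window w L r)) hinj]
      exact (sum_parikhVector_le_length _ _).trans (List.length_take_le _ _))
    (fun r _ l hl => by
      obtain ⟨u, v, hU, huv⟩ := hbal r
      refine sum_Ico_mul_parikhVector_le hσ.sign hU huv (fun i hi => ?_) hl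
      have hiw := List.mem_of_mem_drop (List.mem_of_mem_take hi)
      rw [mem_iff_parikhVector_pos, hw] at hiw
      exact exists_of_chainVec_letterA_ne_zero hiw.ne')
    hbig
  exact ⟨π, τ, hπτ, fun k hk => mem_iff_parikhVector_pos.2 (hτ k hk).2⟩

theorem Touches.and_or_and_of_edge {u v : List (UnivLetter n)} {i j : Fin n} {h : i < j}
    (hc : letterC i j h ∈ u ∨ letterC i j h ∈ v) (hi : Touches u i) (hj : Touches v j) :
    (Touches u i ∧ Touches v i) ∨ (Touches u j ∧ Touches v j) := by
  rcases hc with hc | hc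
  · exact Or.inr ⟨Or.inr (Or.inr ⟨i, h, hc⟩), hj⟩
  · exact Or.inl ⟨hi, Or.inr (Or.inl ⟨j, h, hc⟩)⟩

theorem card_le_two_mul_card_of_adjacent {s t : Finset ℕ} (h : ∀ i ∈ s, i ∈ t ∨ i + 1 ∈ t) :
    #s ≤ 2 * #t := by
  have hsub : s ⊆ t ∪ t.image fun i => i - 1 := fun i hi =>
    (h i hi).elim (fun hit => Finset.mem_union_left _ hit)
      fun hit => Finset.mem_union_right _ (Finset.mem_image.2 ⟨i + 1, hit, rfl⟩)
  calc #s ≤ #t + #(t.image fun i => i - 1) :=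
        (Finset.card_le_card hsub).trans (Finset.card_union_le _ _)
    _ ≤ 2 * #t := by
        rw [two_mul]
        exact Nat.add_le_add_left Finset.card_image_le _

open Classical in
/-- Where the erased symbols alternate, the letter of the edge between two neighbouring nodes lies
on one side of the cut, and the far node of this edge on the other. -/
theorem alternations_le_two_mul_card_touched {u v : List (UnivLetter n)}
    (hw : parikhVector (u ++ v) = chainVec hn σ x N) {τ : ℕ → ℕ} {r : ℕ}
    (hu : ∀ k < m, τ k < r → letterA (chainNode hn σ x (k + 1)) ∈ u)
    (hv : ∀ k < m, r ≤ τ k → letterA (chainNode hn σ x (k + 1)) ∈ v) :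
    alternations (τ · < r) 0 m ≤
      2 * #{k : Fin m | Touches u (chainNode hn σ x (k + 1)) ∧
        Touches v (chainNode hn σ x (k + 1))} := by
  rw [← Finset.card_map Fin.valEmbedding]
  refine card_le_two_mul_card_of_adjacent fun i hi => ?_
  simp only [Finset.mem_filter, Finset.mem_Ico] at hi
  obtain ⟨⟨-, him⟩, hchange⟩ := hi
  have hedge : letterC _ _ (chainNode_lt_of_lt (hn := hn) (σ := σ) x x (k := i + 1)
      (l := i + 1 + 1) (by omega) (by omega)) ∈ u ++ v := by
    rw [mem_iff_parikhVector_pos, hw, chainVec_letterC_pos_iff]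
    exact ⟨i + 1, by omega, rfl, rfl⟩
  rw [List.mem_append] at hedge
  have hboth : (Touches u (chainNode hn σ x (i + 1)) ∧ Touches v (chainNode hn σ x (i + 1))) ∨
      (Touches u (chainNode hn σ x (i + 1 + 1)) ∧ Touches v (chainNode hn σ x (i + 1 + 1))) := by
    rcases lt_or_ge (τ i) r with hi | hi
    · exact Touches.and_or_and_of_edge hedge (Or.inl (hu i (by omega) hi))
        (Or.inl (hv (i + 1) (by omega) (by omega)))
    · exact (Touches.and_or_and_of_edge hedge.symm (Or.inl (hv i (by omega) hi))
        (Or.inl (hu (i + 1) (by omega) (by omega)))).imp And.symm And.symm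
  refine hboth.imp (fun h => ?_) fun h => ?_
  · exact Finset.mem_map.2 ⟨⟨i, by omega⟩, by simpa using h, rfl⟩
  · exact Finset.mem_map.2 ⟨⟨i + 1, by omega⟩, by simpa using h, rfl⟩

open Classical in
theorem exists_multiplicity_exists_touched (hn : 2 * Q * m + 3 ≤ n) (hσ : IsDyck σ m) {A : ℕ}
    (hA : ∀ π τ, RePairing σ m π τ → ∃ r, A ≤ alternations (τ · < r) 0 m) {S : Type} [Finite S]
    (M : NFA (UnivLetter n) S) (hM : parikhImage M.accepts = universalOneCounterSet n) :
    ∃ N, ∀ x : Fin m → Fin Q, ∃ (q : S) (u v : List (UnivLetter n)),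
      q ∈ M.evalFrom M.start u ∧ v ∈ M.acceptsFrom {q} ∧
      parikhVector (u ++ v) = chainVec hn σ x N ∧
      A ≤ 2 * #{k : Fin m | Touches u (chainNode hn σ x (k + 1)) ∧
        Touches v (chainNode hn σ x (k + 1))} := by
  obtain ⟨e, he⟩ := exists_bound_completion M
  obtain ⟨L, N, R, hlen, hbig⟩ := exists_window_parameters n e (m ^ 3)
  refine ⟨N, fun x => ?_⟩
  obtain ⟨w, hw, hwx⟩ : chainVec hn σ x N ∈ parikhImage M.accepts :=
    hM ▸ chainVec_mem_universalOneCounterSet hσ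
  obtain ⟨ρ, hρ⟩ := exists_isAcceptingRun hw
  have hbal (r) : ∃ u v, IsBalanced (parikhVector (u ++ window w L r ++ v)) ∧
      u.length + v.length ≤ e := by
    obtain ⟨u, v, hacc, huv⟩ := he w ρ hρ (r * L) L
    have hU : parikhVector (u ++ window w L r ++ v) ∈ universalOneCounterSet n :=
      hM ▸ ⟨_, hacc, rfl⟩
    exact ⟨u, v, hU.2.1, huv⟩
  obtain ⟨π, τ, hπτ, hτ⟩ := exists_rePairing_of_parikhVector_eq_chainVec hσ hwx hbal hlen hbig
  obtain ⟨r, hr⟩ := hA π τ hπτ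
  have hsplit : parikhVector (w.take (r * L) ++ w.drop (r * L)) = chainVec hn σ x N := by
    rw [List.take_append_drop, hwx]
  exact ⟨ρ (r * L), _, _, hρ.mem_evalFrom_take _, hρ.drop_mem_acceptsFrom _, hsplit,
    hr.trans (alternations_le_two_mul_card_touched hsplit
      (fun k hk hkr => mem_take_of_mem_window hkr (hτ k hk))
      fun k hk hkr => mem_drop_of_mem_window hkr (hτ k hk))⟩

theorem card_le_pow_of_forall_mem_eq {ι β : Type*} [Fintype ι] [Fintype β]
    {T : Finset ι} {P : Finset (ι → β)} (hP : ∀ f ∈ P, ∀ g ∈ P, ∀ i ∈ T, f i = g i) :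
    #P ≤ Fintype.card β ^ (Fintype.card ι - #T) := by
  classical
  have hinj : Set.InjOn (fun (f : ι → β) (i : {i // i ∉ T}) => f i) P := fun f hf g hg hfg => by
    funext i
    by_cases hi : i ∈ T
    exacts [hP f hf g hg i hi, congrFun hfg ⟨i, hi⟩]
  calc #P = #(P.image fun f (i : {i // i ∉ T}) => f i) := (Finset.card_image_of_injOn hinj).symm
    _ ≤ Fintype.card ({i // i ∉ T} → β) := Finset.card_le_univ _
    _ = _ := by
      rw [Fintype.card_fun, Fintype.card_subtype_compl, Fintype.card_coe]

theorem pow_le_card_mul_pow_of_agree {ι β S : Type*} [Fintype ι] [Fintype β] [Nonempty β]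
    [Fintype S] {A : ℕ} (q : (ι → β) → S) (T : (ι → β) → Finset ι)
    (hT : ∀ f, #(T f) = A) (hagree : ∀ f g, q f = q g → T f = T g → ∀ i ∈ T f, f i = g i) :
    Fintype.card β ^ A ≤ Fintype.card S * Fintype.card ι ^ A := by
  classical
  obtain ⟨f₀⟩ : Nonempty (ι → β) := inferInstance
  have hA : A ≤ Fintype.card ι := hT f₀ ▸ Finset.card_le_univ _
  have hmaps : ∀ f ∈ (Finset.univ : Finset (ι → β)),
      (q f, T f) ∈ (Finset.univ : Finset S) ×ˢ Finset.univ.powersetCard A := fun f _ =>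
    Finset.mk_mem_product (Finset.mem_univ _)
      (Finset.mem_powersetCard.2 ⟨Finset.subset_univ _, hT f⟩)
  have hfiber := Finset.card_le_mul_card_image_of_maps_to hmaps
    (Fintype.card β ^ (Fintype.card ι - A)) fun b hb => by
      rw [← (Finset.mem_powersetCard.1 (Finset.mem_product.1 hb).2).2]
      refine card_le_pow_of_forall_mem_eq fun f hf g hg i hi => ?_
      obtain ⟨-, rfl⟩ := Finset.mem_filter.1 hf
      obtain ⟨-, hg⟩ := Finset.mem_filter.1 hg
      rw [Prod.mk.injEq] at hg
      exact hagree f g hg.1.symm hg.2.symm i hi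
  have hpos : 0 < Fintype.card β ^ (Fintype.card ι - A) := pow_pos Fintype.card_pos _
  refine Nat.le_of_mul_le_mul_left ?_ hpos
  calc Fintype.card β ^ (Fintype.card ι - A) * Fintype.card β ^ A = Fintype.card (ι → β) := by
        rw [← pow_add, Nat.sub_add_cancel hA, Fintype.card_fun]
    _ ≤ Fintype.card β ^ (Fintype.card ι - A) * (Fintype.card S * (Fintype.card ι).choose A) := by
        simpa only [Finset.card_product, Finset.card_powersetCard, Finset.card_univ] using hfiber
    _ ≤ _ := Nat.mul_le_mul_left _ (Nat.mul_le_mul_left _ (Nat.choose_le_pow _ _))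

/-- Two chains that give rise to the same state and the same `A` touched nodes share these nodes,
because the second half of one run can be replaced by that of the other. -/
theorem pow_le_card_mul_pow (hn : 2 * Q * m + 3 ≤ n) (hQ : 0 < Q) (hσ : IsDyck σ m) {A : ℕ}
    (hA : ∀ π τ, RePairing σ m π τ → ∃ r, 2 * A ≤ alternations (τ · < r) 0 m + 1) {S : Type}
    [Fintype S] (M : NFA (UnivLetter n) S)
    (hM : parikhImage M.accepts = universalOneCounterSet n) :
    Q ^ A ≤ Fintype.card S * m ^ A := by
  classical
  obtain ⟨N, hN⟩ := exists_multiplicity_exists_touched (A := 2 * A - 1) hn hσ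
    (fun π τ h => (hA π τ h).imp fun r hr => by omega) M hM
  choose q u v hu hv hw htouched using hN
  have hhalf {a : ℕ} (h : 2 * A - 1 ≤ 2 * a) : A ≤ a := by omega
  choose T hTtouched hTA using fun x =>
    Finset.exists_subset_card_eq (hhalf (htouched x))
  have : Nonempty (Fin Q) := ⟨⟨0, hQ⟩⟩
  simpa only [Fintype.card_fin] using pow_le_card_mul_pow_of_agree q T hTA
    fun x y hq hT k hk => by
      have hU : parikhVector (u x ++ v y) ∈ universalOneCounterSet n :=
        hM ▸ ⟨_, append_mem_accepts_of_mem (hu x) (hq ▸ hv y), rfl⟩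
      have htx := (Finset.mem_filter.1 (hTtouched x hk)).2.1
      have hty := (Finset.mem_filter.1 (hTtouched y (hT ▸ hk))).2.2
      exact apply_eq_of_chainNode_succ_eq
        (chainNode_eq_of_append_mem (hw x) (hw y) hU (by omega) htx hty)

end LowerBound

/-! ### Growth of the bound -/

section Growth

theorem hardWordLen_le {M C i j : ℕ} (hMC : (M + 1) ^ j ≤ C) (hC : 2 ≤ C) (hij : i ≤ j) :
    hardWordLen M C i ≤ (2 * C) ^ (i + 1) := by
  induction i with
  | zero =>
    rw [hardWordLen, zero_add, pow_one]
    omega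
  | succ i ih =>
    have hblock : M * (M + 1) ^ i ≤ (2 * C) ^ (i + 1) :=
      calc M * (M + 1) ^ i ≤ (M + 1) ^ (i + 1) := by
            rw [pow_succ']
            exact Nat.mul_le_mul_right _ M.le_succ
        _ ≤ C := (Nat.pow_le_pow_right M.succ_pos hij).trans hMC
        _ ≤ (2 * C) ^ (i + 1) := le_trans (by omega) (Nat.le_self_pow i.succ_ne_zero (2 * C))
    calc hardWordLen M C (i + 1) = C * (hardWordLen M C i + M * (M + 1) ^ i) := rfl
      _ ≤ C * ((2 * C) ^ (i + 1) + (2 * C) ^ (i + 1)) :=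
        Nat.mul_le_mul_left _ (Nat.add_le_add (ih (by omega)) hblock)
      _ = (2 * C) ^ (i + 1 + 1) := by ring

theorem exists_isDyck_forall_exists_le_alternations {j : ℕ} (hj : 1 ≤ j) :
    ∃ σ m, 0 < m ∧ m ≤ (2 * j + 2) ^ ((j + 2) * (j + 1)) ∧ IsDyck σ m ∧
      ∀ π τ, RePairing σ m π τ → ∃ r, j + 1 ≤ alternations (τ · < r) 0 m := by
  obtain ⟨H, hH⟩ : ∃ H, H = (2 * j + 1 + 1) ^ j := ⟨_, rfl⟩
  have hHpos : 0 < H := hH ▸ Nat.pow_pos (Nat.succ_pos _)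
  obtain ⟨C, hC⟩ : ∃ C, C = 2 * H + 4 := ⟨_, rfl⟩
  have hCeven : Even C := ⟨H + 2, by omega⟩
  refine ⟨hardWord (2 * j + 1) C j, hardWordLen (2 * j + 1) C j, hardWordLen_pos (by omega) j, ?_,
    isDyck_hardWord hCeven (by omega) j, fun π τ h => ?_⟩
  · have hbase : 2 * C ≤ (2 * j + 2) ^ (j + 2) :=
      calc 2 * C ≤ 4 * 4 * H := by omega
        _ ≤ (2 * j + 2) * (2 * j + 2) * H :=
          Nat.mul_le_mul_right _ (Nat.mul_le_mul (by omega) (by omega))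
        _ = (2 * j + 2) ^ (j + 2) := by rw [hH]; ring
    rw [pow_mul]
    exact (hardWordLen_le (by omega) (by omega) le_rfl).trans (Nat.pow_le_pow_left hbase _)
  · obtain ⟨r, hr⟩ := h.exists_le_alternations (a := 0) hCeven le_rfl
      (fun i _ => by rw [zero_add]) (zero_add _).le (by
        rw [height, Finset.sum_range_zero, ← hH]
        omega)
    exact ⟨r, by rwa [zero_add] at hr⟩

theorem exists_mul_sq_le_sq {m n : ℕ} (hm₀ : 0 < m) (hn : 256 ≤ n) (hm : m ^ 8 ≤ n) :
    ∃ Q, 2 * Q * m + 3 ≤ n ∧ n * m ^ 2 ≤ Q ^ 2 := by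
  have hm₄ : 16 * m ^ 4 ≤ n := by
    refine (Nat.pow_le_pow_iff_left two_ne_zero).1 ?_
    calc (16 * m ^ 4) ^ 2 = 256 * m ^ 8 := by ring
      _ ≤ n ^ 2 := by rw [sq]; exact Nat.mul_le_mul hn hm
  have hmn : m ≤ m ^ 4 := Nat.le_self_pow four_ne_zero m
  have hdivmod := Nat.div_add_mod (n - 3) (2 * m)
  have hmod := Nat.mod_lt (n - 3) (y := 2 * m) (by omega)
  set Q := (n - 3) / (2 * m)
  have hQ : 2 * m * Q = 2 * Q * m := by ring
  refine ⟨Q, by omega, ?_⟩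
  have hnQ : n ≤ 4 * m * Q := by
    have : 4 * m * Q = 2 * (2 * Q * m) := by ring
    omega
  refine Nat.le_of_mul_le_mul_left ?_ (show 0 < 16 * m ^ 2 by positivity)
  calc 16 * m ^ 2 * (n * m ^ 2) = 16 * m ^ 4 * n := by ring
    _ ≤ n * n := Nat.mul_le_mul_right n hm₄
    _ ≤ (4 * m * Q) * (4 * m * Q) := Nat.mul_le_mul hnQ hnQ
    _ = 16 * m ^ 2 * Q ^ 2 := by ring

theorem pow_le_card_sq {j n : ℕ} (hj : 1 ≤ j) (hn : (2 * j + 2) ^ (8 * ((j + 2) * (j + 1))) ≤ n)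
    {S : Type} [Fintype S] (M : NFA (UnivLetter n) S)
    (hM : parikhImage M.accepts = universalOneCounterSet n) :
    n ^ ((j + 2) / 2) ≤ Fintype.card S ^ 2 := by
  obtain ⟨σ, m, hm₀, hm, hσ, halt⟩ := exists_isDyck_forall_exists_le_alternations hj
  rw [Nat.mul_comm 8, pow_mul] at hn
  have hmn : m ^ 8 ≤ n := (Nat.pow_le_pow_left hm 8).trans hn
  have hn₂ : 256 ≤ n := by
    calc 256 ≤ 4 ^ 8 := by norm_num
      _ ≤ ((2 * j + 2) ^ ((j + 2) * (j + 1))) ^ 8 :=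
        Nat.pow_le_pow_left (le_trans (by omega) (Nat.le_self_pow (by positivity) (2 * j + 2))) 8
      _ ≤ n := hn
  obtain ⟨Q, hQn, hQ⟩ := exists_mul_sq_le_sq hm₀ hn₂ hmn
  have hQ₀ : 0 < Q := by
    have : 0 < n * m ^ 2 := Nat.mul_pos (by omega) (by positivity)
    exact Nat.pos_of_ne_zero fun h => by
      rw [h, zero_pow two_ne_zero] at hQ
      omega
  have hcard : Q ^ ((j + 2) / 2) ≤ Fintype.card S * m ^ ((j + 2) / 2) :=
    pow_le_card_mul_pow hQn hQ₀ hσ (fun π τ h => (halt π τ h).imp fun r hr => by omega) M hM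
  generalize (j + 2) / 2 = A at hcard ⊢
  refine Nat.le_of_mul_le_mul_right ?_ (show 0 < (m ^ A) ^ 2 by positivity)
  calc n ^ A * (m ^ A) ^ 2 = (n * m ^ 2) ^ A := by ring
    _ ≤ (Q ^ 2) ^ A := Nat.pow_le_pow_left hQ A
    _ = (Q ^ A) ^ 2 := by ring
    _ ≤ (Fintype.card S * m ^ A) ^ 2 := Nat.pow_le_pow_left hcard 2
    _ = Fintype.card S ^ 2 * (m ^ A) ^ 2 := mul_pow _ _ 2

theorem eventually_mul_log_le : ∀ᶠ L : ℝ in Filter.atTop,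
    1 ≤ ⌊√(L / Real.log L) / 6⌋₊ ∧ ∀ f : ℝ, 0 ≤ f → f ≤ √(L / Real.log L) / 6 →
      8 * ((f + 2) * (f + 1)) * Real.log (2 * f + 2) ≤ L := by
  have hlarge : ∀ᶠ L : ℝ in Filter.atTop, 144 * Real.log L ≤ L := by
    filter_upwards [Real.isLittleO_log_id_atTop.bound (show (0 : ℝ) < 1 / 144 by norm_num),
      Filter.eventually_ge_atTop 0] with L hL hL₀
    rw [Real.norm_eq_abs, id, Real.norm_of_nonneg hL₀] at hL
    linarith [le_abs_self (Real.log L)]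
  filter_upwards [hlarge, Real.tendsto_log_atTop.eventually_ge_atTop 1,
    Filter.eventually_gt_atTop 0] with L hL hlog hL₀
  set q := √(L / Real.log L) with hq
  have hq₁₂ : 12 ≤ q := Real.le_sqrt_of_sq_le (by rw [le_div_iff₀] <;> linarith)
  have hqL : q * q * Real.log L = L := by
    rw [hq, Real.mul_self_sqrt (by positivity), div_mul_cancel₀ _ (by linarith)]
  refine ⟨Nat.le_floor (by push_cast; linarith), fun f hf₀ hf => ?_⟩
  have hfL : 2 * f + 2 ≤ L := by nlinarith
  have hff : (f + 2) * (f + 1) ≤ q / 3 * (q / 3) := by gcongr <;> linarith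
  calc 8 * ((f + 2) * (f + 1)) * Real.log (2 * f + 2) ≤ 8 * (q / 3 * (q / 3)) * Real.log L := by
        have := Real.log_nonneg (show 1 ≤ 2 * f + 2 by linarith)
        gcongr
    _ = 8 / 9 * (q * q * Real.log L) := by ring
    _ ≤ L := by rw [hqL]; linarith

theorem eventually_pow_floor_le : ∀ᶠ n : ℕ in Filter.atTop,
    ∃ j : ℕ, j = ⌊√(Real.log n / Real.log (Real.log n)) / 6⌋₊ ∧ 1 ≤ j ∧
      (2 * j + 2) ^ (8 * ((j + 2) * (j + 1))) ≤ n := by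
  have hlog := Real.tendsto_log_atTop.comp tendsto_natCast_atTop_atTop
  filter_upwards [hlog.eventually eventually_mul_log_le, Filter.eventually_gt_atTop 0]
    with n ⟨hj, hbound⟩ hn
  simp only [Function.comp_apply] at hj hbound
  refine ⟨_, rfl, hj, ?_⟩
  have hj' := hbound _ (Nat.cast_nonneg _) (Nat.floor_le (by positivity))
  generalize ⌊√(Real.log n / Real.log (Real.log n)) / 6⌋₊ = j at hj'
  rw [← Nat.cast_le (α := ℝ), ← Real.log_le_log_iff (by positivity) (by positivity)]
  push_cast
  rw [Real.log_pow]
  exact_mod_cast hj'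

theorem exists_rpow_sqrt_log_div_log_log_le_card :
    ∃ c : ℝ, 0 < c ∧ ∃ N : ℕ, ∀ n : ℕ, N ≤ n →
      ∀ (S : Type) [Fintype S] (M : NFA (UnivLetter n) S),
        parikhImage M.accepts = universalOneCounterSet n →
        (n : ℝ) ^ (c * √(Real.log n / Real.log (Real.log n))) ≤ (Fintype.card S : ℝ) := by
  obtain ⟨N, hN⟩ := Filter.eventually_atTop.1
    (eventually_pow_floor_le.and (Filter.eventually_ge_atTop 1))
  refine ⟨1 / 24, by norm_num, N, fun n hn S _ M hM => ?_⟩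
  obtain ⟨⟨j, hj, hj₁, hjn⟩, hn₁⟩ := hN n hn
  have hcard := pow_le_card_sq hj₁ hjn M hM
  have hexp : 1 / 24 * √(Real.log n / Real.log (Real.log n)) ≤ ((j + 2) / 2 : ℕ) / 2 := by
    have hfloor := Nat.lt_floor_add_one (√(Real.log n / Real.log (Real.log n)) / 6)
    have hhalf : (j + 1 : ℝ) ≤ 2 * ((j + 2) / 2 : ℕ) := by
      exact_mod_cast (by omega : j + 1 ≤ 2 * ((j + 2) / 2))
    rw [← hj] at hfloor
    linarith
  refine (Real.rpow_le_rpow_of_exponent_le (by exact_mod_cast hn₁) hexp).trans ?_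
  refine (pow_le_pow_iff_left₀ (by positivity) (Nat.cast_nonneg _) two_ne_zero).1 ?_
  rw [← Real.rpow_natCast, ← Real.rpow_mul (Nat.cast_nonneg _), Nat.cast_two,
    div_mul_cancel₀ _ two_ne_zero, Real.rpow_natCast]
  exact_mod_cast hcard

end Growth

/-! ### A one-counter automaton for the universal set -/

section Automaton

variable {n : ℕ} {i j : Fin n} {c : ℕ} {v : UnivLetter n → ℕ}

theorem parikhVector_nil {α : Type} [DecidableEq α] : parikhVector ([] : List α) = 0 :=
  funext fun _ => List.count_nil

theorem parikhVector_cons {α : Type} [DecidableEq α] (a : α) (w : List α) :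
    parikhVector (a :: w) = parikhVector w + Pi.single a 1 := by
  funext b
  simp [parikhVector, List.count_cons, Pi.single_apply, @eq_comm α a]

theorem exists_eq_add_single {α : Type} [DecidableEq α] {v : α → ℕ} {a : α} (ha : 0 < v a) :
    ∃ u : α → ℕ, v = u + Pi.single a 1 :=
  ⟨v - Pi.single a 1, (tsub_add_cancel_of_le
    (update_le_iff.2 ⟨ha, fun _ _ => Nat.zero_le _⟩)).symm⟩

/-- The change of the counter caused by reading the letters `a_j` with `j ∈ T` of the vector `v`. -/
def counterChange (T : Finset (Fin n)) (v : UnivLetter n → ℕ) : ℤ :=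
  ∑ j ∈ T, (-1) ^ (j : ℕ) * (v (letterA j) : ℤ)

theorem counterChange_zero (T : Finset (Fin n)) : counterChange T 0 = 0 := by
  simp [counterChange]

theorem counterChange_add_single_letterA (T : Finset (Fin n)) (i : Fin n)
    (v : UnivLetter n → ℕ) :
    counterChange T (v + Pi.single (letterA i) 1) =
      counterChange T v + if i ∈ T then (-1) ^ (i : ℕ) else 0 := by
  simp [counterChange, letterA, Pi.single_apply, mul_add, Finset.sum_add_distrib]

theorem counterChange_add_single_letterC (T : Finset (Fin n)) (h : i < j)
    (v : UnivLetter n → ℕ) :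
    counterChange T (v + Pi.single (letterC i j h) 1) = counterChange T v := by
  simp [counterChange, letterA, letterC]

/-- The edges of the strictly increasing path `p` from `i` to `n - 1` are counted by the components
`y_{kl}` of `v`, and the letters `a_k` of `v` belong to nodes of `p`. -/
structure IsChainFrom (i : Fin n) (v : UnivLetter n → ℕ) {t : ℕ} (p : Fin (t + 1) → Fin n) :
    Prop where
  strictMono : StrictMono p
  first : p 0 = i
  last : (p (Fin.last t) : ℕ) + 1 = n
  edge : ∀ (k l : Fin n) (h : k < l),
    v (letterC k l h) = if ∃ s : Fin t, p s.castSucc = k ∧ p s.succ = l then 1 else 0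
  node : ∀ k, 0 < v (letterA k) → k ∈ Set.range p

/-- The vector `v` is a candidate for what the automaton reads from the node `i` and the counter
value `c` until it accepts: it is supported on a chain from `i`, and the counter never becomes
negative and ends at `0`. -/
def IsReadableFrom (i : Fin n) (c : ℕ) (v : UnivLetter n → ℕ) : Prop :=
  (∃ (t : ℕ) (p : Fin (t + 1) → Fin n), IsChainFrom i v p) ∧
    (∀ k, i ≤ k → 0 ≤ c + counterChange (Finset.Iic k) v) ∧
    c + counterChange Finset.univ v = 0

namespace IsChainFrom

variable {t : ℕ} {p : Fin (t + 1) → Fin n}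

theorem le (hp : IsChainFrom i v p) (s : Fin (t + 1)) : i ≤ p s :=
  hp.first ▸ hp.strictMono.monotone (Fin.zero_le s)

theorem le_of_letterA_pos (hp : IsChainFrom i v p) (hj : 0 < v (letterA j)) : i ≤ j := by
  obtain ⟨s, rfl⟩ := hp.node j hj
  exact hp.le s

theorem letterA_eq_zero_of_lt (hp : IsChainFrom i v p) (hj : j < i) : v (letterA j) = 0 :=
  Nat.eq_zero_of_not_pos fun h => hj.not_ge (hp.le_of_letterA_pos h)

theorem counterChange_eq_zero (hp : IsChainFrom i v p) {T : Finset (Fin n)}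
    (hT : ∀ j ∈ T, j < i) : counterChange T v = 0 :=
  Finset.sum_eq_zero fun j hj => by
    rw [hp.letterA_eq_zero_of_lt (hT j hj), Nat.cast_zero, mul_zero]

theorem counterChange_Iic_self (hp : IsChainFrom i v p) :
    counterChange (Finset.Iic i) v = (-1) ^ (i : ℕ) * (v (letterA i) : ℤ) := by
  have hIio : counterChange (Finset.Iio i) v = 0 :=
    hp.counterChange_eq_zero fun _ => Finset.mem_Iio.1
  rw [counterChange] at hIio ⊢
  rw [← Finset.Iio_insert, Finset.sum_insert (by simp), hIio, add_zero]

theorem add_single_letterA_iff :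
    IsChainFrom i (v + Pi.single (letterA i) 1) p ↔ IsChainFrom i v p := by
  have hA (k : Fin n) : 0 < (v + Pi.single (letterA i) 1 : UnivLetter n → ℕ) (letterA k) ↔
      0 < v (letterA k) ∨ k = i := by
    by_cases h : k = i <;> simp [letterA, h]
  have hC (k l : Fin n) (h : k < l) :
      (v + Pi.single (letterA i) 1 : UnivLetter n → ℕ) (letterC k l h) = v (letterC k l h) := by
    simp [letterA, letterC]
  refine ⟨fun hp => ⟨hp.strictMono, hp.first, hp.last, fun k l h => ?_, fun k hk => ?_⟩,
    fun hp => ⟨hp.strictMono, hp.first, hp.last, fun k l h => ?_, fun k hk => ?_⟩⟩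
  · rw [← hC, hp.edge]
  · exact hp.node k ((hA k).2 (Or.inl hk))
  · rw [hC, hp.edge]
  · rcases (hA k).1 hk with hk | rfl
    · exact hp.node k hk
    · exact ⟨0, hp.first⟩

end IsChainFrom

theorem exists_edge_cons {α : Type*} {t : ℕ} {x : α} {p : Fin (t + 1) → α} {k l : α} :
    (∃ s : Fin (t + 1), (Fin.cons x p : Fin (t + 2) → α) s.castSucc = k ∧
      (Fin.cons x p : Fin (t + 2) → α) s.succ = l) ↔
      (x = k ∧ p 0 = l) ∨ ∃ s : Fin t, p s.castSucc = k ∧ p s.succ = l := by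
  simp only [Fin.exists_fin_succ, ← Fin.succ_castSucc, Fin.castSucc_zero, Fin.cons_zero,
    Fin.cons_succ]

theorem ite_exists_edge_cons {t : ℕ} {p : Fin (t + 1) → Fin n} (hp : ∀ s, i < p s) (k l : Fin n) :
    (if ∃ s : Fin (t + 1), (Fin.cons i p : Fin (t + 2) → Fin n) s.castSucc = k ∧
      (Fin.cons i p : Fin (t + 2) → Fin n) s.succ = l then 1 else 0) =
      (if ∃ s : Fin t, p s.castSucc = k ∧ p s.succ = l then 1 else 0) +
        if i = k ∧ p 0 = l then 1 else 0 := by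
  have hdisj : i = k ∧ p 0 = l → ¬ ∃ s : Fin t, p s.castSucc = k ∧ p s.succ = l := by
    rintro ⟨rfl, -⟩ ⟨s, hs, -⟩
    exact (hp s.castSucc).ne' hs
  simp only [exists_edge_cons]
  by_cases h : i = k ∧ p 0 = l
  · rw [if_pos (Or.inl h), if_neg (hdisj h), if_pos h]
  · simp only [h, false_or, if_false, add_zero]

theorem isChainFrom_cons_iff (h : i < j) (hi : v (letterA i) = 0) {t : ℕ}
    {p : Fin (t + 1) → Fin n} (hp₀ : p 0 = j) :
    IsChainFrom i (v + Pi.single (letterC i j h) 1) (Fin.cons i p : Fin (t + 2) → Fin n) ↔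
      IsChainFrom j v p := by
  have hA (k : Fin n) :
      (v + Pi.single (letterC i j h) 1 : UnivLetter n → ℕ) (letterA k) = v (letterA k) := by
    simp [letterA, letterC]
  have hC (k l : Fin n) (hkl : k < l) :
      (v + Pi.single (letterC i j h) 1 : UnivLetter n → ℕ) (letterC k l hkl) =
        v (letterC k l hkl) + if i = k ∧ p 0 = l then 1 else 0 := by
    simp [letterC, Pi.single_apply, hp₀, @eq_comm _ i, @eq_comm _ j]
  have hlast : (Fin.cons i p : Fin (t + 2) → Fin n) (Fin.last (t + 1)) = p (Fin.last t) := by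
    rw [← Fin.succ_last, Fin.cons_succ]
  constructor
  · intro hc
    obtain ⟨hlt, hmono⟩ := Fin.strictMono_cons.1 hc.strictMono
    refine ⟨hmono, hp₀, hlast ▸ hc.last, fun k l hkl => ?_, fun k hk => ?_⟩
    · have hedge := hc.edge k l hkl
      rwa [hC, ite_exists_edge_cons hlt, Nat.add_right_cancel_iff] at hedge
    · obtain ⟨s, rfl⟩ := hc.node k (by rwa [hA])
      rcases Fin.eq_zero_or_eq_succ s with rfl | ⟨s, rfl⟩
      · exact absurd hi hk.ne'
      · exact ⟨s, (Fin.cons_succ (α := fun _ => Fin n) i p s).symm⟩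
  · intro hc
    have hlt (s : Fin (t + 1)) : i < p s := h.trans_le (hc.le s)
    refine ⟨Fin.strictMono_cons.2 ⟨hlt, hc.strictMono⟩, rfl, hlast ▸ hc.last, fun k l hkl => ?_,
      fun k hk => ?_⟩
    · rw [hC, hc.edge, ite_exists_edge_cons hlt]
    · obtain ⟨s, rfl⟩ := hc.node k (by rwa [hA] at hk)
      exact ⟨s.succ, Fin.cons_succ _ _ _⟩

theorem IsChainFrom.eq_cons_tail {t : ℕ} {p : Fin (t + 1) → Fin n} (hp : IsChainFrom i v p)
    {h : i < j} (hv : 0 < v (letterC i j h)) :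
    ∃ (r : ℕ) (q : Fin (r + 1) → Fin n), q 0 = j ∧
      IsChainFrom i v (Fin.cons i q : Fin (r + 2) → Fin n) := by
  rw [hp.edge] at hv
  obtain ⟨s, hs₁, hs₂⟩ : ∃ s : Fin t, p s.castSucc = i ∧ p s.succ = j := by
    by_contra hne
    exact hv.ne' (if_neg hne)
  cases t with
  | zero => exact s.elim0
  | succ t =>
    obtain rfl : s = 0 :=
      Fin.castSucc_injective _ (hp.strictMono.injective (hs₁.trans hp.first.symm))
    refine ⟨t, Fin.tail p, hs₂, ?_⟩
    have hcons : (Fin.cons i (Fin.tail p) : Fin (t + 2) → Fin n) = p := by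
      rw [← hp.first, Fin.cons_self_tail]
    rwa [hcons]

theorem isReadableFrom_add_single_letterC_iff (h : i < j) (hi : v (letterA i) = 0) :
    IsReadableFrom i c (v + Pi.single (letterC i j h) 1) ↔ IsReadableFrom j c v := by
  simp only [IsReadableFrom, counterChange_add_single_letterC]
  constructor
  · rintro ⟨⟨t, p, hp⟩, hnonneg, hzero⟩
    obtain ⟨r, q, hq₀, hq⟩ := hp.eq_cons_tail (j := j) (h := h) (by simp)
    exact ⟨⟨r, q, (isChainFrom_cons_iff h hi hq₀).1 hq⟩, fun k hk => hnonneg k (h.le.trans hk),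
      hzero⟩
  · rintro ⟨⟨t, p, hp⟩, hnonneg, hzero⟩
    refine ⟨⟨t + 1, _, (isChainFrom_cons_iff h hi hp.first).2 hp⟩, fun k _ => ?_, hzero⟩
    rcases le_or_gt j k with hjk | hkj
    · exact hnonneg k hjk
    · rw [hp.counterChange_eq_zero fun l hl => (Finset.mem_Iic.1 hl).trans_lt hkj, add_zero]
      exact c.cast_nonneg

theorem isReadableFrom_add_single_letterA_iff :
    IsReadableFrom i c (v + Pi.single (letterA i) 1) ↔
      ∃ d : ℕ, (d : ℤ) = c + (-1) ^ (i : ℕ) ∧ IsReadableFrom i d v := by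
  simp only [IsReadableFrom, IsChainFrom.add_single_letterA_iff, counterChange_add_single_letterA,
    Finset.mem_univ, if_true, Finset.mem_Iic]
  constructor
  · rintro ⟨⟨t, p, hp⟩, hnonneg, hzero⟩
    have hd : 0 ≤ c + (-1 : ℤ) ^ (i : ℕ) := by
      have hi := hnonneg i le_rfl
      rw [if_pos le_rfl, hp.counterChange_Iic_self] at hi
      rcases neg_one_pow_eq_or ℤ (i : ℕ) with h | h <;> rw [h] at hi ⊢ <;> omega
    refine ⟨_, Int.toNat_of_nonneg hd, ⟨t, p, hp⟩, fun k hk => ?_, ?_⟩ <;>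
      rw [Int.toNat_of_nonneg hd]
    · have := hnonneg k hk
      rw [if_pos hk] at this
      linarith
    · linarith
  · rintro ⟨d, hd, hchain, hnonneg, hzero⟩
    refine ⟨hchain, fun k hk => ?_, by linarith⟩
    have := hnonneg k hk
    rw [if_pos hk]
    linarith

theorem isReadableFrom_iff_of_succ_eq (hi : (i : ℕ) + 1 = n) (hv : v (letterA i) = 0) :
    IsReadableFrom i c v ↔ c = 0 ∧ v = 0 := by
  constructor
  · rintro ⟨⟨t, p, hp⟩, -, hzero⟩
    obtain rfl : v = 0 := by
      funext a
      rcases a with ⟨⟨k, l⟩, hkl⟩ | k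
      · refine (hp.edge k l hkl).trans (if_neg ?_)
        rintro ⟨s, rfl, -⟩
        have hle := hp.le s.castSucc
        have hlt : p s.castSucc < l := hkl
        omega
      · refine Nat.eq_zero_of_not_pos fun hk => hk.ne' ?_
        have := hp.le_of_letterA_pos hk
        obtain rfl : k = i := by omega
        exact hv
    rw [counterChange_zero, add_zero] at hzero
    exact ⟨by exact_mod_cast hzero, rfl⟩
  · rintro ⟨rfl, rfl⟩
    refine ⟨⟨0, fun _ => i, Subsingleton.strictMono (α := Fin 1) _, rfl, hi, by simp, by simp⟩,
      fun k _ => ?_, ?_⟩ <;> simp [counterChange_zero]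

theorem IsReadableFrom.exists_letterC_pos (h : IsReadableFrom i c v) (hi : (i : ℕ) + 1 ≠ n) :
    ∃ (j : Fin n) (hij : i < j), 0 < v (letterC i j hij) := by
  obtain ⟨⟨t, p, hp⟩, -⟩ := h
  cases t with
  | zero => exact absurd (hp.first ▸ hp.last) hi
  | succ t =>
    have hlt : i < p 1 := hp.first ▸ hp.strictMono Fin.zero_lt_one
    exact ⟨p 1, hlt, by rw [hp.edge, if_pos ⟨0, hp.first, rfl⟩]; exact one_pos⟩

theorem IsReadableFrom.letterA_eq_zero_of_lt (h : IsReadableFrom j c v) (hij : i < j) :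
    v (letterA i) = 0 := by
  obtain ⟨⟨t, p, hp⟩, -⟩ := h
  exact hp.letterA_eq_zero_of_lt hij

theorem mem_universalOneCounterSet_iff (hn : 0 < n) :
    v ∈ universalOneCounterSet n ↔ IsReadableFrom ⟨0, hn⟩ 0 v := by
  have hle (k : Fin n) : (⟨0, hn⟩ : Fin n) ≤ k := Fin.le_def.2 k.val.zero_le
  simp only [IsReadableFrom, Nat.cast_zero, zero_add]
  constructor
  · rintro ⟨⟨h01, t, p, hp, hp₀, hpt, hedge⟩, ⟨hzero, hnonneg⟩, hcomp⟩
    refine ⟨⟨t, p, hp, Fin.ext hp₀, hpt, fun k l h => ?_, fun k hk => ?_⟩, fun k _ => ?_, hzero⟩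
    · simp only [← hedge k l h]
      rcases h01 k l h with h | h <;> simp [h]
    · rcases Nat.eq_zero_or_pos (k : ℕ) with hk₀ | hk₀
      · exact ⟨0, Fin.ext (hp₀.trans hk₀.symm)⟩
      · obtain ⟨i, hi, hik⟩ := (hcomp k hk).1 hk₀
        obtain ⟨s, -, hs⟩ := (hedge i k hi).1 hik
        exact ⟨_, hs⟩
    · rcases Nat.lt_or_ge ((k : ℕ) + 1) n with hk | hk
      · exact hnonneg k hk
      · have huniv : Finset.Iic k = Finset.univ :=
          Finset.eq_univ_iff_forall.2 fun l => Finset.mem_Iic.2 (by omega)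
        rw [huniv]
        exact hzero.ge
  · rintro ⟨⟨t, p, hp⟩, hnonneg, hzero⟩
    have hedge (k l : Fin n) (h : k < l) :
        v (letterC k l h) = 1 ↔ ∃ s : Fin t, p s.castSucc = k ∧ p s.succ = l := by
      rw [hp.edge]
      split_ifs with hs <;> simp [hs]
    refine ⟨⟨fun k l h => ?_, t, p, hp.strictMono, congrArg Fin.val hp.first, hp.last, hedge⟩,
      ⟨hzero, fun k _ => hnonneg k (hle k)⟩, fun k hk => ?_⟩
    · rw [hp.edge]
      exact (ite_eq_or_eq _ _ _).symm
    · obtain ⟨s, rfl⟩ := hp.node k hk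
      refine ⟨fun h₀ => ?_, fun h₁ => ?_⟩
      · rcases Fin.eq_zero_or_eq_succ s with rfl | ⟨s, rfl⟩
        · exact absurd (congrArg Fin.val hp.first) h₀.ne'
        · exact ⟨_, hp.strictMono Fin.castSucc_lt_succ, (hedge _ _ _).2 ⟨s, rfl, rfl⟩⟩
      · rcases Fin.eq_castSucc_or_eq_last s with ⟨s, rfl⟩ | rfl
        · exact ⟨_, hp.strictMono Fin.castSucc_lt_succ, (hedge _ _ _).2 ⟨s, rfl, rfl⟩⟩
        · exact absurd hp.last h₁.ne

instance : Fintype CounterOp where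
  elems := ⟨{.inc, .dec, .nop, .zeroTest}, by simp⟩
  complete o := by cases o <;> simp

/-- The operation on the counter when `a_i` is read. -/
def nodeOp (i : ℕ) : CounterOp := if Even i then .inc else .dec

theorem nodeOp_step_iff {i c d : ℕ} : (nodeOp i).Step c d ↔ (d : ℤ) = c + (-1) ^ i := by
  unfold nodeOp
  split_ifs with h
  · rw [h.neg_one_pow, CounterOp.Step]
    omega
  · rw [(Nat.not_even_iff_odd.1 h).neg_one_pow, CounterOp.Step]
    omega

/-- The state of `univOCA n` in which it visits the node `i`. -/
def nodeState (i : Fin n) : Fin (n + 2) := (i.castSucc).castSucc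

/-- The final state of `univOCA n`. -/
def finalState (n : ℕ) : Fin (n + 2) := Fin.last (n + 1)

theorem nodeState_ne_finalState (i : Fin n) : nodeState i ≠ finalState n :=
  (Fin.castSucc_lt_last _).ne

theorem nodeState_injective : Function.Injective (nodeState (n := n)) :=
  (Fin.castSucc_injective _).comp (Fin.castSucc_injective _)

/-- The transitions of `univOCA n`: it follows a chain, reads letters `a_i` while it visits the
node `i`, and accepts from the node `n - 1` if the counter is `0`. -/
inductive UnivTrans (n : ℕ) :
    Fin (n + 2) × Option (UnivLetter n) × CounterOp × Fin (n + 2) → Prop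
  | loop (i : Fin n) : UnivTrans n (nodeState i, some (letterA i), nodeOp i, nodeState i)
  | edge (i j : Fin n) (h : i < j) :
      UnivTrans n (nodeState i, some (letterC i j h), .nop, nodeState j)
  | test (i : Fin n) (h : (i : ℕ) + 1 = n) :
      UnivTrans n (nodeState i, none, .zeroTest, finalState n)

/-- A one-counter automaton with `n + 2` states, one of them isolated, whose language has the
Parikh image `U_n`. -/
noncomputable def univOCA (n : ℕ) : OCA (UnivLetter n) (Fin (n + 2)) where
  trans := (Set.toFinite {x | UnivTrans n x}).toFinset
  start := 0
  accept := {finalState n}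

theorem mem_univOCA_trans {x : Fin (n + 2) × Option (UnivLetter n) × CounterOp × Fin (n + 2)} :
    x ∈ (univOCA n).trans ↔ UnivTrans n x := by
  simp [univOCA]

theorem isReadableFrom_of_run {q r : Fin (n + 2)} {c d : ℕ} {w : List (UnivLetter n)}
    (h : (univOCA n).Run q c w r d) (hr : r = finalState n) :
    (q = finalState n → w = []) ∧
      ∀ i : Fin n, q = nodeState i → IsReadableFrom i c (parikhVector w) := by
  induction h with
  | nil q c =>
    exact ⟨fun _ => rfl, fun i hi => absurd (hi.symm.trans hr) (nodeState_ne_finalState i)⟩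
  | cons q q' r c c' d a o w htrans hstep hrun ih =>
    obtain ⟨ih_final, ih_node⟩ := ih hr
    cases mem_univOCA_trans.1 htrans with
    | loop i =>
      refine ⟨fun h => absurd h (nodeState_ne_finalState i), fun k hk => ?_⟩
      obtain rfl := nodeState_injective hk
      rw [Option.toList_some, List.singleton_append, parikhVector_cons,
        isReadableFrom_add_single_letterA_iff]
      exact ⟨c', nodeOp_step_iff.1 hstep, ih_node i rfl⟩
    | edge i j hij =>
      refine ⟨fun h => absurd h (nodeState_ne_finalState i), fun k hk => ?_⟩
      obtain rfl := nodeState_injective hk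
      obtain rfl : c' = c := hstep
      have hj := ih_node j rfl
      rwa [Option.toList_some, List.singleton_append, parikhVector_cons,
        isReadableFrom_add_single_letterC_iff hij (hj.letterA_eq_zero_of_lt hij)]
    | test i hi =>
      refine ⟨fun h => absurd h (nodeState_ne_finalState i), fun k hk => ?_⟩
      obtain rfl := nodeState_injective hk
      obtain ⟨rfl, rfl⟩ := hstep
      rw [ih_final rfl, Option.toList_none, List.append_nil, parikhVector_nil,
        isReadableFrom_iff_of_succ_eq hi rfl]
      exact ⟨rfl, rfl⟩

theorem IsReadableFrom.exists_run (h : IsReadableFrom i c v) :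
    ∃ w, (univOCA n).Run (nodeState i) c w (finalState n) 0 ∧ parikhVector w = v := by
  induction v using WellFoundedLT.induction generalizing i c with
  | ind v ih =>
    have hlt (u : UnivLetter n → ℕ) (a : UnivLetter n) : u < u + Pi.single a 1 :=
      lt_add_of_pos_right u (Pi.single_pos.2 one_pos)
    rcases Nat.eq_zero_or_pos (v (letterA i)) with hi | hi
    · by_cases hlast : (i : ℕ) + 1 = n
      · obtain ⟨rfl, rfl⟩ := (isReadableFrom_iff_of_succ_eq hlast hi).1 h
        exact ⟨[], .cons _ _ _ 0 0 0 none _ [] (mem_univOCA_trans.2 (.test i hlast)) ⟨rfl, rfl⟩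
          (.nil _ _), parikhVector_nil⟩
      · obtain ⟨j, hij, hj⟩ := h.exists_letterC_pos hlast
        obtain ⟨u, rfl⟩ := exists_eq_add_single hj
        have hui : u (letterA i) = 0 := Nat.eq_zero_of_add_eq_zero_right hi
        have hu := (isReadableFrom_add_single_letterC_iff hij hui).1 h
        obtain ⟨w, hrun, rfl⟩ := ih u (hlt u _) hu
        exact ⟨letterC i j hij :: w, .cons _ _ _ c c 0 (some _) _ w
          (mem_univOCA_trans.2 (.edge i j hij)) rfl hrun, parikhVector_cons _ w⟩
    · obtain ⟨u, rfl⟩ := exists_eq_add_single hi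
      obtain ⟨d, hd, hu⟩ := isReadableFrom_add_single_letterA_iff.1 h
      obtain ⟨w, hrun, rfl⟩ := ih u (hlt u _) hu
      exact ⟨letterA i :: w, .cons _ _ _ c d 0 (some _) _ w
        (mem_univOCA_trans.2 (.loop i)) (nodeOp_step_iff.2 hd) hrun, parikhVector_cons _ w⟩

theorem parikhImage_univOCA (hn : 0 < n) :
    parikhImage (univOCA n).accepts = universalOneCounterSet n := by
  have hstart : (univOCA n).start = nodeState ⟨0, hn⟩ := rfl
  ext v
  rw [mem_universalOneCounterSet_iff hn]
  constructor
  · rintro ⟨w, ⟨q, hq, d, hrun⟩, rfl⟩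
    exact (isReadableFrom_of_run hrun hq).2 _ hstart
  · intro h
    obtain ⟨w, hrun, hw⟩ := h.exists_run
    exact ⟨w, ⟨finalState n, rfl, 0, hstart ▸ hrun⟩, hw⟩

end Automaton

/-! ### No polynomial translation -/

section PolynomialTranslation

theorem OCA.size_le {α Q : Type} [Fintype α] [Fintype Q] (A : OCA α Q) :
    A.size ≤ Fintype.card Q + Fintype.card α +
      Fintype.card Q * ((Fintype.card α + 1) * (4 * Fintype.card Q)) := by
  classical
  have hcard : Fintype.card CounterOp = 4 := rfl
  have htrans := A.trans.card_le_univ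
  rw [Fintype.card_prod, Fintype.card_prod, Fintype.card_prod, Fintype.card_option, hcard]
    at htrans
  exact Nat.add_le_add_left htrans _

theorem card_univLetter_le (n : ℕ) : Fintype.card (UnivLetter n) ≤ n * n + n := by
  rw [Fintype.card_sum, Fintype.card_fin]
  exact Nat.add_le_add_right ((Fintype.card_subtype_le _).trans (by simp)) n

theorem size_le_pow_of_two_le {n : ℕ} (hn : 2 ≤ n) (A : OCA (UnivLetter n) (Fin (n + 2))) :
    A.size ≤ n ^ 10 := by
  have hα : Fintype.card (UnivLetter n) + 1 ≤ 2 * n ^ 2 := by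
    have := card_univLetter_le n
    nlinarith
  have hsize := A.size_le
  rw [Fintype.card_fin] at hsize
  calc A.size ≤ 2 * n + 2 * n ^ 2 + 2 * n * (2 * n ^ 2 * (4 * (2 * n))) := by
        refine hsize.trans ?_
        gcongr <;> omega
    _ = 2 * n + 2 * n ^ 2 + 32 * n ^ 4 := by ring
    _ ≤ 2 * n ^ 4 + 2 * n ^ 4 + 32 * n ^ 4 := by
        have hn₁ : n ≤ n ^ 4 := Nat.le_self_pow four_ne_zero n
        have hn₂ : n ^ 2 ≤ n ^ 4 := Nat.pow_le_pow_right (by omega) (by norm_num)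
        omega
    _ ≤ 2 ^ 6 * n ^ 4 := by omega
    _ ≤ n ^ 6 * n ^ 4 := Nat.mul_le_mul_right _ (Nat.pow_le_pow_left hn 6)
    _ = n ^ 10 := by ring

theorem polynomial_eval_le_eval_one_mul_pow (P : Polynomial ℕ) {x y : ℕ} (hxy : x ≤ y)
    (hy : 1 ≤ y) : P.eval x ≤ P.eval 1 * y ^ P.natDegree := by
  rw [Polynomial.eval_eq_sum_range, Polynomial.eval_eq_sum_range, Finset.sum_mul]
  refine Finset.sum_le_sum fun i hi => ?_
  rw [one_pow, mul_one]
  calc P.coeff i * x ^ i ≤ P.coeff i * y ^ i := by gcongr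
    _ ≤ P.coeff i * y ^ P.natDegree := by
      gcongr
      exact Finset.mem_range_succ_iff.1 hi

theorem tendsto_sqrt_div_log_atTop :
    Filter.Tendsto (fun x : ℝ => √(x / Real.log x)) Filter.atTop Filter.atTop := by
  refine Real.tendsto_sqrt_atTop.comp ?_
  have hpos : ∀ᶠ x : ℝ in Filter.atTop, 0 < Real.log x / id x := by
    filter_upwards [Filter.eventually_gt_atTop 1] with x hx
    exact div_pos (Real.log_pos hx) (one_pos.trans hx)
  refine (Filter.Tendsto.inv_tendsto_nhdsGT_zero (tendsto_nhdsWithin_iff.2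
    ⟨Real.isLittleO_log_id_atTop.tendsto_div_nhds_zero, hpos⟩)).congr fun x => ?_
  exact inv_div _ _

theorem not_exists_polynomial_translation :
    ¬ ∃ P : Polynomial ℕ,
      ∀ (α Q : Type) [Fintype α] [DecidableEq α] [Fintype Q] (A : OCA α Q),
        ∃ (S : Type) (_ : Fintype S) (M : NFA α S),
          parikhImage M.accepts = parikhImage A.accepts ∧ Fintype.card S ≤ P.eval A.size := by
  rintro ⟨P, hP⟩
  obtain ⟨c, hc, N, hN⟩ := exists_rpow_sqrt_log_div_log_log_le_card
  set D := 10 * P.natDegree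
  have hsqrt := (tendsto_sqrt_div_log_atTop.comp
    (Real.tendsto_log_atTop.comp tendsto_natCast_atTop_atTop)).eventually_ge_atTop ((D + 1) / c)
  obtain ⟨n, ⟨⟨hexp, hnN⟩, hnP⟩, hn⟩ := (((hsqrt.and (Filter.eventually_ge_atTop N)).and
    (Filter.eventually_gt_atTop (P.eval 1))).and (Filter.eventually_ge_atTop 2)).exists
  obtain ⟨S, _, M, hM, hS⟩ := hP (UnivLetter n) (Fin (n + 2)) (univOCA n)
  rw [parikhImage_univOCA (by omega)] at hM
  simp only [Function.comp_apply] at hexp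
  rw [div_le_iff₀' hc] at hexp
  have hlower : n ^ (D + 1) ≤ Fintype.card S := by
    have hrpow : (n : ℝ) ^ ((D + 1 : ℕ) : ℝ) ≤ Fintype.card S :=
      (Real.rpow_le_rpow_of_exponent_le (by exact_mod_cast one_le_two.trans hn)
        (by exact_mod_cast hexp)).trans (hN n hnN S M hM)
    rw [Real.rpow_natCast] at hrpow
    exact_mod_cast hrpow
  have hupper : Fintype.card S ≤ P.eval 1 * n ^ D := by
    rw [pow_mul]
    exact hS.trans (polynomial_eval_le_eval_one_mul_pow P (size_le_pow_of_two_le hn _)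
      (Nat.one_le_pow _ _ (by omega)))
  have hnP' : n * n ^ D ≤ P.eval 1 * n ^ D := by
    rw [← pow_succ']
    exact hlower.trans hupper
  exact hnP.not_ge (Nat.le_of_mul_le_mul_right hnP' (Nat.pow_pos (by omega)))

end PolynomialTranslation

theorem mainTheorem2_general :
    (∃ c : ℝ, 0 < c ∧ ∃ N : ℕ, ∀ n : ℕ, N ≤ n →
      ∀ (S : Type) [Fintype S] (M : NFA (UnivLetter n) S),
        parikhImage M.accepts = universalOneCounterSet n →
        (n : ℝ) ^ (c * √(Real.log n / Real.log (Real.log n))) ≤ (Fintype.card S : ℝ)) ∧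
    (∀ n : ℕ, 0 < n →
      ∃ A : OCA (UnivLetter n) (Fin (n + 2)),
        parikhImage A.accepts = universalOneCounterSet n) ∧
    ¬ ∃ P : Polynomial ℕ,
      ∀ (α Q : Type) [Fintype α] [DecidableEq α] [Fintype Q] (A : OCA α Q),
        ∃ (S : Type) (_ : Fintype S) (M : NFA α S),
          parikhImage M.accepts = parikhImage A.accepts ∧ Fintype.card S ≤ P.eval A.size :=
  ⟨exists_rpow_sqrt_log_div_log_log_le_card,
    fun n hn => ⟨univOCA n, parikhImage_univOCA hn⟩, not_exists_polynomial_translation⟩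

theorem mainTheorem2 :
    -- every NFA for `U_n` has `n ^ Ω(√(log n / log log n))` states
    (∃ c : ℝ, 0 < c ∧ ∃ N : ℕ, ∀ n : ℕ, N ≤ n → Even n →
      ∀ (S : Type) [Fintype S] (M : NFA (UnivLetter n) S),
        parikhImage M.accepts = universalOneCounterSet n →
        (n : ℝ) ^ (c * Real.sqrt (Real.log n / Real.log (Real.log n))) ≤ (Fintype.card S : ℝ)) ∧
    -- `U_n` is the Parikh image of the language of a one-counter automaton with `n + 2` states
    (∀ n : ℕ, 2 ≤ n → Even n →
      ∃ A : OCA (UnivLetter n) (Fin (n + 2)),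
        parikhImage A.accepts = universalOneCounterSet n) ∧
    -- there is no polynomial translation from one-counter automata to Parikh-equivalent NFA
    ¬ ∃ P : Polynomial ℕ,
      ∀ (α Q : Type) [Fintype α] [DecidableEq α] [Fintype Q] (A : OCA α Q),
        ∃ (S : Type) (_ : Fintype S) (M : NFA α S),
          parikhImage M.accepts = parikhImage A.accepts ∧ Fintype.card S ≤ P.eval A.size := by
  obtain ⟨⟨c, hc, N, hlower⟩, hOCA, htranslation⟩ := mainTheorem2_general
  exact ⟨⟨c, hc, N, fun n hn _ => hlower n hn⟩, fun n hn _ => hOCA n (by omega), htranslation⟩
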